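/- **Setting.** Let $H$ be a separable real Hilbert space, $p\in[2,\infty)$, $\mathcal P_p(H)$ the set of Borel probability measures $\mu$ on $H$ with $\|\mu\|_p=(\int|x|_H^p\,\mu(dx))^{1/p}<\infty$, and $W_p$ the Wasserstein distance $W_p(\mu,\nu)=\inf_\Gamma(\int|x-y|_H^p\,\Gamma(dx,dy))^{1/p}$ over couplings $\Gamma$ of $\mu,\nu$. Let $(\Omega,\mathcal F,\mathbb P,(\mathcal F_t)_{t\ge0})$ be a filtered probability space carrying an $\mathcal F_0$-measurable random variable uniform on $[0,1]$, and let $L^p_t(H)$ be the set of $\mathcal F_t$-measurable $X:\Omega\to H$ with $\|X\|_p=\mathbb E[|X|_H^p]^{1/p}<\infty$. Let $\Theta_{s,t}:\mathcal P_p(H)\to\mathcal P_p(H)$, $0\le s\le t$, with $\Theta_{t,t}=\mathrm{Id}$. *$\beta$-sewing property* (with constants $L_{sew},C_{sew}>0$): there are operators $\mathcal X_{s,r,t}=(\mathcal X^1_{s,r,t},\mathcal X^2_{s,r,t}):L^p_s(H)^2\to L^p_t(H)^2$, $s\le r\le t$, such that, with $\widehat{\mathcal E}^\ell(X)=\mathbb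 E[\mathcal X^\ell_{s,r,t}(X)-X^\ell\mid\mathcal F_s]$ and $\widetilde{\mathcal E}^\ell(X)=\mathcal X^\ell_{s,r,t}(X)-X^\ell-\widehat{\mathcal E}^\ell(X)$, for all $s\le r\le t$ and $X=(X^1,X^2)\in L^p_s(H)^2$: * if $X^1\sim\mu^1$ and $X^2\sim\mu^2$, then $\mathcal X^1_{s,r,t}(X)\sim\Theta_{s,t}(\mu^1)$ and $\mathcal X^2_{s,r,t}(X)\sim\Theta_{r,t}\circ\Theta_{s,r}(\mu^2)$; * $\|\widehat{\mathcal E}^1(X)\|_p\le L_{sew}(t-s)(1+\|X^1\|_p)$ and $\|\widetilde{\mathcal E}^1(X)\|_p\le L_{sew}(t-s)^{1/2}(1+\|X^1\|_p)$; * $\|\widehat{\mathcal E}^2(X)-\widehat{\mathcal E}^1(X)\|_p\le C_{sew}(t-s)\,D$ and $\|\widetilde{\mathcal E}^2(X)-\widetilde{\mathcal E}^1(X)\|_p\le C_{sew}(t-s)^{1/2}D$, where $D=\|X^1-X^2\|_p+(1+\|X^1\|_p+\|X^2\|_p)(t-s)^\beta$. *Property* $\mathbf C$: there is a nondecreasing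 $\varphi:[0,\infty)\to[0,\infty)$ with $\lim_{\delta\downarrow0}\varphi(\delta)=0$ and $W_p(\Theta_{s,t}(\mu),\mu)\le(1+\|\mu\|_p)\varphi(t-s)$ for all $0\le s<t$ and $\mu\in\mathcal P_p(H)$. For a partition $\pi=\{s=t_0<\dots<t_N=t\}$ of $[s,t]$ put $|\pi|=\max_i(t_i-t_{i-1})$ and $\Theta^\pi_{s,t}=\Theta_{t_{N-1},t_N}\circ\dots\circ\Theta_{t_0,t_1}$. Let $\Theta^n_{s,t}$ be the composition of the maps $\Theta_{k2^{-n},(k+1)2^{-n}}$, $\lfloor2^ns\rfloor\le k<\lfloor2^nt\rfloor$, in increasing order of $k$ (first applied $k=\lfloor 2^ns\rfloor$). A *limit flow* of $\Theta$ is a family $\theta_{s,t}:\mathcal P_p(H)\to\mathcal P_p(H)$, $0\le s\le t$, with $\theta_{s,t}=\theta_{r,t}\circ\theta_{s,r}$ for $s\le r\le t$ and $W_p(\Theta^n_{s,t}(\mu),\theta_{s,t}(\mu))\to0$ as $n\to\infty$ for all $s<t$ and $\mu\in\mathcal P_p(H)$. **Theorem 2.7 (speed of convergence).** Let $p\ge2$,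 $\beta>0$, $T>0$, $L_{sew}>0$, $C_{sew}>0$. There is a constant $C'_T\in\mathbb R_+$, depending only on $T,p,L_{sew},C_{sew},\beta$, such that in the above setting, whenever $\Theta$ has the $\beta$-sewing property with constants $L_{sew},C_{sew}$ and satisfies $\mathbf C$, a limit flow of $\Theta$ exists, and every limit flow $\theta$ of $\Theta$ satisfies, for all $0\le s<t\le T$, all $\mu\in\mathcal P_p(H)$ and every partition $\pi$ of $[s,t]$, $$W_p(\Theta^\pi_{s,t}(\mu),\theta_{s,t}(\mu))\le C'_T(1+\|\mu\|_p)(t-s)^{1/2}|\pi|^\beta .$$ In particular, $W_p(\Theta_{s,t}(\mu),\theta_{s,t}(\mu))\le C'_T(1+\|\mu\|_p)(t-s)^{1/2+\beta}$. -/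

import Mathlib

open MeasureTheory ProbabilityTheory Filter Topology
open scoped NNReal ENNReal

namespace WassersteinSewing

/-- The space `𝒫_p(H)` of Borel probability measures on `H` with finite moment of order `p`. -/
@[ext]
structure PSpace (p : ℝ≥0) (H : Type*) [NormedAddCommGroup H] [MeasurableSpace H] where
  /-- the underlying measure -/
  toMeasure : Measure H
  isProbabilityMeasure : IsProbabilityMeasure toMeasure
  memLp : MemLp (fun x : H => x) p toMeasure

section Spaces

variable {p : ℝ≥0} {H : Type*} [NormedAddCommGroup H] [MeasurableSpace H]

/-- `‖μ‖_p = (∫ |x|^p μ(dx))^{1/p}`, a finite element of `[0, ∞]`. -/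
noncomputable def PSpace.norm (μ : PSpace p H) : ℝ≥0∞ :=
  eLpNorm (fun x : H => x) p μ.toMeasure

/-- Couplings of two measures: measures on the product with the given marginals.
(When both marginals are in `𝒫_p(H)`, a coupling is automatically a probability measure with
finite moment of order `p`.) -/
def IsCoupling (μ ν : Measure H) (Γ : Measure (H × H)) : Prop :=
  Γ.map Prod.fst = μ ∧ Γ.map Prod.snd = ν

/-- The Wasserstein distance
`W_p(μ, ν) = inf_Γ (∫ |x - y|^p Γ(dx, dy))^{1/p}`, the infimum over all couplings `Γ`. -/
noncomputable def W (μ ν : PSpace p H) : ℝ≥0∞ :=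
  ⨅ (Γ : Measure (H × H)) (_ : IsCoupling μ.toMeasure ν.toMeasure Γ),
    eLpNorm (fun z : H × H => z.1 - z.2) p Γ

end Spaces

/-- A partition `s = t_0 < t_1 < ⋯ < t_N = t` of `[s, t]`; the values `pt i` with `i > N` play
no role. -/
structure Partition (s t : ℝ≥0) where
  /-- the number `N` of steps -/
  N : ℕ
  /-- the points `t_i` -/
  pt : ℕ → ℝ≥0
  pt_zero : pt 0 = s
  pt_last : pt N = t
  pt_lt : ∀ i < N, pt i < pt (i + 1)

/-- The mesh `|π| = max_{1 ≤ i ≤ N} (t_i - t_{i-1})`. -/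
noncomputable def Partition.mesh {s t : ℝ≥0} (π : Partition s t) : ℝ≥0 :=
  (Finset.range π.N).sup fun i => π.pt (i + 1) - π.pt i

section Schemes

variable {E : Type*}

/-- `compose Θ τ N = Θ_{τ(N-1),τ(N)} ∘ ⋯ ∘ Θ_{τ(0),τ(1)}`, the identity if `N = 0`. -/
def compose (Θ : ℝ≥0 → ℝ≥0 → E → E) (τ : ℕ → ℝ≥0) : ℕ → E → E
  | 0, μ => μ
  | k + 1, μ => Θ (τ k) (τ (k + 1)) (compose Θ τ k μ)

/-- The scheme `Θ^π_{s,t}` of a partition `π` of `[s, t]`. -/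
def scheme (Θ : ℝ≥0 → ℝ≥0 → E → E) {s t : ℝ≥0} (π : Partition s t) : E → E :=
  compose Θ π.pt π.N

/-- The dyadic scheme `Θ^n_{s,t}`: the composition over all steps of length `2^{-n}` from
`⌊2^n s⌋ / 2^n` to `⌊2^n t⌋ / 2^n`. -/
noncomputable def dyadicScheme (Θ : ℝ≥0 → ℝ≥0 → E → E) (n : ℕ) (s t : ℝ≥0) : E → E :=
  compose Θ (fun k => ((⌊2 ^ n * s⌋₊ + k : ℕ) : ℝ≥0) / 2 ^ n) (⌊2 ^ n * t⌋₊ - ⌊2 ^ n * s⌋₊)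

end Schemes

section Coupling

variable {H : Type*} [NormedAddCommGroup H] [MeasurableSpace H]
variable {Ω : Type*} {mΩ : MeasurableSpace Ω}

/-- The filtered space carries a uniform random variable on `[0,1]` that is
`ℱ_0`-measurable. -/
def Atomless (ℱ : Filtration ℝ≥0 mΩ) (P : Measure Ω) : Prop :=
  ∃ U : Ω → ℝ, Measurable[ℱ 0] U ∧ P.map U = volume.restrict (Set.Icc (0 : ℝ) 1)

/-- `L^p_t(H)`: the `ℱ_t`-measurable random variables `X : Ω → H` with `‖X‖_p < ∞`. -/
def LpAt (H : Type*) [NormedAddCommGroup H] [MeasurableSpace H]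
    (p : ℝ≥0) (ℱ : Filtration ℝ≥0 mΩ) (P : Measure Ω) (t : ℝ≥0) : Type _ :=
  {X : Ω → H // Measurable[ℱ t] X ∧ MemLp X p P}

/-- `Ê = 𝔼_{ℱ_s}(Y - X)`, the conditional expectation of an increment. -/
noncomputable def hatInc [NormedSpace ℝ H] [CompleteSpace H] (ℱ : Filtration ℝ≥0 mΩ)
    (P : Measure Ω) (s : ℝ≥0) (X Y : Ω → H) : Ω → H :=
  P[Y - X | ℱ s]

/-- `Ẽ = (Y - X) - Ê`, the martingale part of an increment. -/
noncomputable def tildeInc [NormedSpace ℝ H] [CompleteSpace H] (ℱ : Filtration ℝ≥0 mΩ)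
    (P : Measure Ω) (s : ℝ≥0) (X Y : Ω → H) : Ω → H :=
  (Y - X) - hatInc ℱ P s X Y

/-- `𝒳` is a `β`-coupling family of operators for `Θ` with constants `L` and `C`. Here
`(X.1.1, X.2.1)` is the input pair of random variables and `((𝒳 s r t X).1.1, (𝒳 s r t X).2.1)`
the output pair. Only times `s ≤ r ≤ t` matter. -/
structure IsCouplingFamily [NormedSpace ℝ H] [CompleteSpace H] {p : ℝ≥0}
    (ℱ : Filtration ℝ≥0 mΩ) (P : Measure Ω)
    (Θ : ℝ≥0 → ℝ≥0 → PSpace p H → PSpace p H) (β : ℝ) (L C : ℝ≥0)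
    (𝒳 : ∀ s _r t : ℝ≥0, LpAt H p ℱ P s × LpAt H p ℱ P s → LpAt H p ℱ P t × LpAt H p ℱ P t) :
    Prop where
  /-- Representation, first marginal. -/
  repr_one : ∀ s r t : ℝ≥0, s ≤ r → r ≤ t → ∀ (μ₁ μ₂ : PSpace p H)
    (X : LpAt H p ℱ P s × LpAt H p ℱ P s),
    P.map X.1.1 = μ₁.toMeasure → P.map X.2.1 = μ₂.toMeasure →
      P.map (𝒳 s r t X).1.1 = (Θ s t μ₁).toMeasure
  /-- Representation, second marginal. -/
  repr_two : ∀ s r t : ℝ≥0, s ≤ r → r ≤ t → ∀ (μ₁ μ₂ : PSpace p H)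
    (X : LpAt H p ℱ P s × LpAt H p ℱ P s),
    P.map X.1.1 = μ₁.toMeasure → P.map X.2.1 = μ₂.toMeasure →
      P.map (𝒳 s r t X).2.1 = (Θ r t (Θ s r μ₂)).toMeasure
  /-- Growth, finite variation part. -/
  growth_hat : ∀ s r t : ℝ≥0, s ≤ r → r ≤ t → ∀ X : LpAt H p ℱ P s × LpAt H p ℱ P s,
    eLpNorm (hatInc ℱ P s X.1.1 (𝒳 s r t X).1.1) p P ≤
      (L * (t - s) : ℝ≥0) * (1 + eLpNorm X.1.1 p P)
  /-- Growth, martingale part. -/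
  growth_tilde : ∀ s r t : ℝ≥0, s ≤ r → r ≤ t → ∀ X : LpAt H p ℱ P s × LpAt H p ℱ P s,
    eLpNorm (tildeInc ℱ P s X.1.1 (𝒳 s r t X).1.1) p P ≤
      (L * (t - s) ^ (1 / 2 : ℝ) : ℝ≥0) * (1 + eLpNorm X.1.1 p P)
  /-- Stochastic sewing, finite variation part. -/
  sewing_hat : ∀ s r t : ℝ≥0, s ≤ r → r ≤ t → ∀ X : LpAt H p ℱ P s × LpAt H p ℱ P s,
    eLpNorm (hatInc ℱ P s X.2.1 (𝒳 s r t X).2.1 - hatInc ℱ P s X.1.1 (𝒳 s r t X).1.1) p P ≤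
      (C * (t - s) : ℝ≥0) * (eLpNorm (X.1.1 - X.2.1) p P +
        (1 + (eLpNorm X.1.1 p P + eLpNorm X.2.1 p P)) * ((t - s) ^ β : ℝ≥0))
  /-- Stochastic sewing, martingale part. -/
  sewing_tilde : ∀ s r t : ℝ≥0, s ≤ r → r ≤ t → ∀ X : LpAt H p ℱ P s × LpAt H p ℱ P s,
    eLpNorm (tildeInc ℱ P s X.2.1 (𝒳 s r t X).2.1 -
        tildeInc ℱ P s X.1.1 (𝒳 s r t X).1.1) p P ≤
      (C * (t - s) ^ (1 / 2 : ℝ) : ℝ≥0) * (eLpNorm (X.1.1 - X.2.1) p P +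
        (1 + (eLpNorm X.1.1 p P + eLpNorm X.2.1 p P)) * ((t - s) ^ β : ℝ≥0))

/-- The `β`-sewing property of `Θ`, with constants `L` and `C`, on the given filtered
probability space. -/
def SewingProperty [NormedSpace ℝ H] [CompleteSpace H] {p : ℝ≥0}
    (ℱ : Filtration ℝ≥0 mΩ) (P : Measure Ω)
    (Θ : ℝ≥0 → ℝ≥0 → PSpace p H → PSpace p H) (β : ℝ) (L C : ℝ≥0) : Prop :=
  ∃ 𝒳, IsCouplingFamily ℱ P Θ β L C 𝒳

/-- The uniform continuity property on the diagonal. -/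
def ContinuityProperty {p : ℝ≥0} (Θ : ℝ≥0 → ℝ≥0 → PSpace p H → PSpace p H) : Prop :=
  ∃ φ : ℝ≥0 → ℝ≥0, Monotone φ ∧ Tendsto φ (𝓝[>] 0) (𝓝 0) ∧
    ∀ s t : ℝ≥0, s < t → ∀ μ : PSpace p H, W (Θ s t μ) μ ≤ (1 + μ.norm) * φ (t - s)

/-- `θ` is a flow, and it is the limit in `W_p` of the dyadic schemes of `Θ`. -/
structure IsLimitFlow {p : ℝ≥0} (Θ θ : ℝ≥0 → ℝ≥0 → PSpace p H → PSpace p H) : Prop where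
  flow : ∀ s r t : ℝ≥0, s ≤ r → r ≤ t → θ s t = θ r t ∘ θ s r
  tendsto : ∀ s t : ℝ≥0, s < t → ∀ μ : PSpace p H,
    Tendsto (fun n : ℕ => W (dyadicScheme Θ n s t μ) (θ s t μ)) atTop (𝓝 0)

end Coupling

end WassersteinSewing

open WassersteinSewing

universe u v

set_option linter.unusedSectionVars false

namespace WassersteinSewing

/-! ### Wasserstein space: gluing, metric axioms, completeness, realization of laws -/

section Measures

variable {p : ℝ≥0} {H : Type*} [NormedAddCommGroup H] [MeasurableSpace H]

/-! The heart is a stability estimate for inserting at most one point into each gap of a partition.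
Start from random variables representing two measures, and apply the operators of the sewing
property gap by gap: the output pair is measurable at the end of the gap and represents the two
schemes there, so it can serve as the next input. Over a gap of length `η`, at most the mesh `h`,
the difference of the pair, of norm `d`, gains a conditional mean of order `η (d + E)` and a
martingale increment of order `η^{1/2} (d + E)`, where `E` is of order `h^β`. Adding norms would
lose a power of the mesh. But `L^p(Ω; H)` is 2-smooth for `p ≥ 2` (`exists_isSmoothConst`), so a
martingale increment enters through its square: `d'² ≤ d² (1 + M η) + M η E²`. A discrete Gronwall
argument (`coupled_run`) and a square root give the cost `(t - s)^{1/2} h^β`, uniformly in the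
number of points (`SchemeEstimate`).

An arbitrary partition `A` then reaches a fine grid in three kinds of simple insertions
(`run_grid`). The multiples of some `δ` larger than the mesh fall into distinct gaps of `A`. Halving
the grid repeatedly inserts one point per gap at most, and its costs form a geometric series of
ratio `2^{-β}`. Once the grid is finer than the smallest gap of `A`, the points of `A` are
themselves a simple insertion into the grid, and removing them costs only a power of the fine mesh.

The same halving estimate makes the schemes on dyadic grids Cauchy, and completeness of `W` gives a
limit. Property `C` serves only to pass between the grids ending at `s` and `t` and the dyadic
schemes with rounded endpoints, with an error that vanishes in the limit; so `φ` does not affect the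
constant. Stability in the initial measure gives the flow property. -/

lemma IsCoupling.isProbabilityMeasure {μ ν : Measure H} [IsProbabilityMeasure μ]
    {Γ : Measure (H × H)} (h : IsCoupling μ ν Γ) : IsProbabilityMeasure Γ := by
  constructor
  have := congrArg (fun m => m Set.univ) h.1
  simpa [Measure.map_apply measurable_fst] using this

instance PSpace.instIsProbabilityMeasure (μ : PSpace p H) : IsProbabilityMeasure μ.toMeasure :=
  μ.isProbabilityMeasure

lemma PSpace.norm_ne_top (μ : PSpace p H) : μ.norm ≠ ∞ := μ.memLp.eLpNorm_ne_top

variable [BorelSpace H]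

lemma eLpNorm_eq_of_map_eq [SecondCountableTopology H] {Ω : Type*} [MeasurableSpace Ω]
    {P : Measure Ω} {X : Ω → H} (hX : Measurable X) {μ : PSpace p H} (h : P.map X = μ.toMeasure) :
    eLpNorm X p P = μ.norm := by
  rw [PSpace.norm, ← h, eLpNorm_map_measure (by fun_prop) hX.aemeasurable]
  rfl

lemma memLp_of_map_eq [SecondCountableTopology H] {Ω : Type*} [MeasurableSpace Ω]
    {P : Measure Ω} {X : Ω → H} (hX : Measurable X) {μ : PSpace p H} (h : P.map X = μ.toMeasure) : MemLp X p P := by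
  have := μ.memLp
  rw [← h] at this
  exact this.comp_of_map hX.aemeasurable

lemma W_le_of_map [SecondCountableTopology H] {Ω : Type*} [MeasurableSpace Ω] {P : Measure Ω}
    {X Y : Ω → H} (hX : Measurable X) (hY : Measurable Y) {μ ν : PSpace p H}
    (h₁ : P.map X = μ.toMeasure) (h₂ : P.map Y = ν.toMeasure) :
    W μ ν ≤ eLpNorm (X - Y) p P := by
  refine iInf₂_le_of_le (P.map fun ω => (X ω, Y ω)) ⟨?_, ?_⟩ ?_
  · rw [Measure.map_map measurable_fst (by fun_prop)]; exact h₁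
  · rw [Measure.map_map measurable_snd (by fun_prop)]; exact h₂
  · rw [eLpNorm_map_measure (by fun_prop) (by fun_prop)]
    rfl

lemma W_self (μ : PSpace p H) [SecondCountableTopology H] : W μ μ = 0 := by
  refine le_antisymm ?_ zero_le
  refine (W_le_of_map (P := μ.toMeasure) measurable_id measurable_id (by simp) (by simp)).trans ?_
  simp

lemma W_comm [SecondCountableTopology H] (μ ν : PSpace p H) : W μ ν = W ν μ := by
  have key : ∀ μ ν : PSpace p H, W μ ν ≤ W ν μ := by
    intro μ ν
    refine le_iInf₂ fun Γ hΓ => ?_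
    refine (W_le_of_map measurable_snd measurable_fst hΓ.2 hΓ.1).trans ?_
    rw [eLpNorm_sub_comm]
    rfl
  exact le_antisymm (key _ _) (key _ _)

/-- Gluing a sequence of couplings along their common marginals. -/
lemma exists_glue [StandardBorelSpace H] (m : ℕ → Measure H) [∀ n, IsProbabilityMeasure (m n)]
    (Γ : ℕ → Measure (H × H)) (hΓ : ∀ n, IsCoupling (m n) (m (n + 1)) (Γ n)) :
    ∃ Q : Measure (ℕ → H), IsProbabilityMeasure Q ∧
      ∀ n, Q.map (fun x => (x n, x (n + 1))) = Γ n := by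
  have : ∀ n, IsProbabilityMeasure (Γ n) := fun n => (hΓ n).isProbabilityMeasure
  -- A Markov chain: coordinate `n + 1` is drawn from the conditional law under `Γ n` given
  -- coordinate `n`. The Ionescu-Tulcea theorem supplies the law of the whole trajectory.
  let κ : (n : ℕ) → Kernel (Π _ : Finset.Iic n, H) H := fun n =>
    (Γ n).condKernel.comap (fun x => x ⟨n, by simp⟩) (by fun_prop)
  have : ∀ n, IsMarkovKernel (κ n) := fun n => by dsimp only [κ]; infer_instance
  let Q : Measure (ℕ → H) := Kernel.trajMeasure (X := fun _ => H) (m 0) κ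
  have hQ : IsProbabilityMeasure Q := by dsimp only [Q]; infer_instance
  have step : ∀ n, Q.map (fun x => x n) = m n → Q.map (fun x => (x n, x (n + 1))) = Γ n := by
    intro n hn
    have h1 := Kernel.map_frestrictLe_trajMeasure_compProd_eq_map_trajMeasure
      (X := fun _ => H) (μ₀ := m 0) (κ := κ) (a := n)
    have h2 := congrArg (Measure.map (fun z : (Π _ : Finset.Iic n, H) × H =>
      (z.1 ⟨n, by simp⟩, z.2))) h1
    rw [Measure.map_map (by fun_prop) (by fun_prop)] at h2
    refine h2.symm.trans ?_
    have h3 : (Q.map (Preorder.frestrictLe (π := fun _ => H) n)).map (fun x => x ⟨n, by simp⟩) =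
        (Γ n).fst := by
      rw [Measure.map_map (by fun_prop) (by fun_prop), Measure.fst, (hΓ n).1, ← hn]
      rfl
    conv_rhs => rw [← (Γ n).disintegrate (Γ n).condKernel, ← h3]
    ext s hs
    rw [Measure.map_apply (by fun_prop) hs, Measure.compProd_apply (hs.preimage (by fun_prop)),
      Measure.compProd_apply hs, lintegral_map (Kernel.measurable_kernel_prodMk_left hs)
        (by fun_prop)]
    rfl
  have marg : ∀ n, Q.map (fun x => x n) = m n := by
    intro n
    induction n with
    | zero =>
      have h0 : Q.map (Preorder.frestrictLe (π := fun _ => H) 0) =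
          (m 0).map (MeasurableEquiv.piUnique (fun _ : Finset.Iic 0 => H)).symm := by
        dsimp only [Q]
        rw [Kernel.trajMeasure, Measure.map_comp _ _ (by fun_prop), Kernel.traj_map_frestrictLe,
          Kernel.partialTraj_self, Measure.id_comp]
      have h1 := congrArg (Measure.map (fun z : (Π _ : Finset.Iic 0, H) => z ⟨0, by simp⟩)) h0
      rw [Measure.map_map (by fun_prop) (by fun_prop),
        Measure.map_map (by fun_prop) (by fun_prop)] at h1
      refine h1.trans ?_
      exact Measure.map_id
    | succ n ih =>
      rw [← (hΓ n).2, ← step n ih, Measure.map_map measurable_snd (by fun_prop)]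
      rfl
  exact ⟨Q, hQ, fun n => step n (marg n)⟩

lemma W_triangle [SecondCountableTopology H] [StandardBorelSpace H] (hp : 1 ≤ p) (μ ν ρ : PSpace p H) :
    W μ ρ ≤ W μ ν + W ν ρ := by
  conv_rhs => rw [W, W]
  simp_rw [ENNReal.iInf_add, ENNReal.add_iInf]
  refine le_iInf₂ fun Γ₁ h₁ => le_iInf₂ fun Γ₂ h₂ => ?_
  -- The gluing lemma takes an infinite chain, so the chain `μ, ν, ρ` is padded by copies of `ρ`
  -- with diagonal couplings.
  have hd : IsCoupling ρ.toMeasure ρ.toMeasure (ρ.toMeasure.map fun x => (x, x)) := by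
    constructor <;> rw [Measure.map_map (by fun_prop) (by fun_prop)] <;> exact Measure.map_id
  let m : ℕ → PSpace p H
    | 0 => μ
    | 1 => ν
    | _ + 2 => ρ
  obtain ⟨Q, hQ, hQΓ⟩ := exists_glue (fun n => (m n).toMeasure)
    (fun | 0 => Γ₁ | 1 => Γ₂ | _ + 2 => ρ.toMeasure.map fun x => (x, x))
    (fun n => match n with | 0 => h₁ | 1 => h₂ | _ + 2 => hd)
  have e₁ := hQΓ 0
  have e₂ := hQΓ 1
  simp only [zero_add, Nat.reduceAdd] at e₁ e₂
  have l₁ : Q.map (fun x => x 0) = μ.toMeasure := by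
    rw [← h₁.1, ← e₁, Measure.map_map (by fun_prop) (by fun_prop)]; rfl
  have l₂ : Q.map (fun x => x 2) = ρ.toMeasure := by
    rw [← h₂.2, ← e₂, Measure.map_map (by fun_prop) (by fun_prop)]; rfl
  refine (W_le_of_map (by fun_prop) (by fun_prop) l₁ l₂).trans ?_
  rw [← e₁, ← e₂, eLpNorm_map_measure (by fun_prop) (by fun_prop),
    eLpNorm_map_measure (by fun_prop) (by fun_prop)]
  refine le_trans (le_of_eq ?_) (eLpNorm_add_le (by fun_prop) (by fun_prop) (by exact_mod_cast hp))
  congr 1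
  ext x
  simp

/-- Markov's inequality for a coupling gives `μ F ≤ ν (F_δ) + δ^{-p} ε^p` for every `ε > 0`. Let `ε
→ 0`, then `δ → 0`; closed sets form a generating π-system. -/
lemma eq_of_W_eq_zero [SecondCountableTopology H] {μ ν : PSpace p H} (hp : 1 ≤ p) (h : W μ ν = 0) :
    μ = ν := by
  have key : ∀ μ ν : PSpace p H, W μ ν = 0 → ∀ F : Set H, IsClosed F →
      μ.toMeasure F ≤ ν.toMeasure F := by
    intro μ ν h F hF
    have hp0 : (p : ℝ≥0∞) ≠ 0 := by
      simpa using (zero_lt_one.trans_le hp).ne'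
    have hδ : ∀ δ : ℝ, 0 < δ → μ.toMeasure F ≤ ν.toMeasure (Metric.cthickening δ F) := by
      intro δ hδ
      have hδ' : ENNReal.ofReal δ ≠ 0 := by simpa using hδ
      have hε : ∀ ε : ℝ≥0∞, 0 < ε → μ.toMeasure F ≤ ν.toMeasure (Metric.cthickening δ F) +
          (ENNReal.ofReal δ)⁻¹ ^ (p : ℝ≥0∞).toReal * ε ^ (p : ℝ≥0∞).toReal := by
        intro ε hε
        rw [← h, W] at hε
        simp only [iInf_lt_iff] at hε
        obtain ⟨Γ, hΓ, hlt⟩ := hε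
        have h1 := meas_ge_le_mul_pow_eLpNorm_enorm Γ hp0 ENNReal.coe_ne_top
          (f := fun z : H × H => z.1 - z.2) (by fun_prop) hδ' (by simp)
        refine le_trans ?_ (add_le_add_right (h1.trans (mul_le_mul_right
          (ENNReal.rpow_le_rpow hlt.le ENNReal.toReal_nonneg) _)) _)
        rw [← hΓ.1, ← hΓ.2, Measure.map_apply measurable_fst hF.measurableSet,
          Measure.map_apply measurable_snd Metric.isClosed_cthickening.measurableSet]
        refine (measure_mono ?_).trans (measure_union_le _ _)
        intro z hz
        by_cases hzδ : ENNReal.ofReal δ ≤ ‖z.1 - z.2‖ₑ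
        · exact Or.inr hzδ
        · left
          refine Metric.mem_cthickening_of_edist_le z.2 z.1 δ F hz ?_
          rw [edist_comm, edist_eq_enorm_sub]
          exact (not_le.1 hzδ).le
      have ht : Tendsto (fun ε : ℝ≥0∞ => ν.toMeasure (Metric.cthickening δ F) +
          (ENNReal.ofReal δ)⁻¹ ^ (p : ℝ≥0∞).toReal * ε ^ (p : ℝ≥0∞).toReal) (𝓝[>] 0)
          (𝓝 (ν.toMeasure (Metric.cthickening δ F) +
          (ENNReal.ofReal δ)⁻¹ ^ (p : ℝ≥0∞).toReal * 0 ^ (p : ℝ≥0∞).toReal)) := by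
        refine Tendsto.const_add _ (ENNReal.Tendsto.const_mul ?_ (Or.inr ?_))
        · exact (ENNReal.continuous_rpow_const.tendsto 0).mono_left nhdsWithin_le_nhds
        · exact ENNReal.rpow_ne_top_of_nonneg ENNReal.toReal_nonneg (by simpa using hδ)
      rw [ENNReal.zero_rpow_of_pos (ENNReal.toReal_pos hp0 ENNReal.coe_ne_top), mul_zero,
        add_zero] at ht
      exact ge_of_tendsto ht (eventually_mem_nhdsWithin.mono hε)
    have := (tendsto_measure_cthickening_of_isClosed (μ := ν.toMeasure)
      ⟨1, one_pos, measure_ne_top _ _⟩ hF).mono_left (nhdsWithin_le_nhds (s := Set.Ioi 0))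
    exact ge_of_tendsto this (eventually_mem_nhdsWithin.mono hδ)
  apply PSpace.ext
  refine ext_of_generate_finite _ (BorelSpace.measurable_eq.trans borel_eq_generateFrom_isClosed)
    isPiSystem_isClosed ?_ (by simp)
  intro F hF
  exact le_antisymm (key μ ν h F hF) (key ν μ (by rwa [W_comm]) F hF)

/-- Gluing almost optimal couplings turns the sequence of laws into a Cauchy sequence in one space
`L^p(Q)`; the law of its limit is the required measure. The slack `2⁻¹ ^ n` replaces the existence
of optimal couplings. -/
lemma exists_limit [SecondCountableTopology H] [CompleteSpace H] (hp : 1 ≤ p) (μ : ℕ → PSpace p H)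
    (h : ∑' n, W (μ n) (μ (n + 1)) ≠ ∞) :
    ∃ ν : PSpace p H, Tendsto (fun n => W (μ n) ν) atTop (𝓝 0) := by
  have hlt : ∀ n, W (μ n) (μ (n + 1)) < W (μ n) (μ (n + 1)) + 2⁻¹ ^ n := fun n =>
    ENNReal.lt_add_right (ENNReal.ne_top_of_tsum_ne_top h n) (by simp)
  have hΓ : ∀ n, ∃ Γ : Measure (H × H), IsCoupling (μ n).toMeasure (μ (n + 1)).toMeasure Γ ∧
      eLpNorm (fun z : H × H => z.1 - z.2) p Γ ≤ W (μ n) (μ (n + 1)) + 2⁻¹ ^ n := by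
    intro n
    have := hlt n
    conv_lhs at this => rw [W]
    simp only [iInf_lt_iff] at this
    obtain ⟨Γ, h₁, h₂⟩ := this
    exact ⟨Γ, h₁, h₂.le⟩
  choose Γ hΓ hΓle using hΓ
  obtain ⟨Q, hQ, hQΓ⟩ := exists_glue (fun n => (μ n).toMeasure) Γ hΓ
  have law : ∀ n, Q.map (fun x => x n) = (μ n).toMeasure := fun n => by
    rw [← (hΓ n).1, ← hQΓ n, Measure.map_map (by fun_prop) (by fun_prop)]; rfl
  have mem : ∀ n, MemLp (fun x : ℕ → H => x n) p Q := fun n =>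
    memLp_of_map_eq (by fun_prop) (law n)
  have : Fact (1 ≤ (p : ℝ≥0∞)) := ⟨by exact_mod_cast hp⟩
  have hcau : CauchySeq fun n => (mem n).toLp := by
    refine cauchySeq_of_edist_le_of_tsum_ne_top (fun n => W (μ n) (μ (n + 1)) + 2⁻¹ ^ n) ?_ ?_
    · intro n
      rw [Lp.edist_toLp_toLp]
      refine le_trans (le_of_eq ?_) (hΓle n)
      rw [← hQΓ n, eLpNorm_map_measure (by fun_prop) (by fun_prop)]
      rfl
    · rw [ENNReal.tsum_add, ENNReal.tsum_geometric]
      exact ENNReal.add_ne_top.2 ⟨h, by simp⟩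
  obtain ⟨f, hf⟩ := cauchySeq_tendsto_of_complete hcau
  have hfm : Measurable f := (Lp.stronglyMeasurable f).measurable
  let ν : PSpace p H := ⟨Q.map f, Measure.isProbabilityMeasure_map hfm.aemeasurable, by
    rw [memLp_map_measure_iff (by fun_prop) hfm.aemeasurable]
    exact Lp.memLp f⟩
  refine ⟨ν, ?_⟩
  rw [tendsto_iff_edist_tendsto_0] at hf
  refine tendsto_of_tendsto_of_tendsto_of_le_of_le tendsto_const_nhds hf (fun _ => zero_le) ?_
  intro n
  refine (W_le_of_map (by fun_prop) hfm (law n) rfl).trans (le_of_eq ?_)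
  rw [← Lp.edist_toLp_toLp _ _ (mem n) (Lp.memLp f), Lp.toLp_coeFn]

/-- Every law on a standard Borel space is an image of Lebesgue measure on the unit interval, and
the uniform variable carries that measure. -/
lemma exists_map_eq_of_atomless {E : Type*} [MeasurableSpace E] [StandardBorelSpace E]
    {Ω : Type*} {mΩ : MeasurableSpace Ω} {ℱ : Filtration ℝ≥0 mΩ} {P : Measure Ω}
    (hA : Atomless ℱ P) (Γ : Measure E) [IsProbabilityMeasure Γ] :
    ∃ X : Ω → E, Measurable[ℱ 0] X ∧ P.map X = Γ := by
  obtain ⟨U, hU, hUm⟩ := hA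
  have : Nonempty E := by
    by_contra hE
    rw [not_nonempty_iff] at hE
    have := measure_univ (μ := Γ)
    rw [Set.eq_empty_of_isEmpty Set.univ] at this
    simp at this
  obtain ⟨f, hf, hfm⟩ := Measure.exists_measurable_map_eq Γ
  let g : ℝ → E := fun x => f (Set.projIcc 0 1 zero_le_one x)
  have hg : Measurable g := hf.comp (continuous_projIcc.measurable)
  refine ⟨g ∘ U, hg.comp hU, ?_⟩
  rw [← Measure.map_map hg (hU.mono (ℱ.le 0) le_rfl), hUm, ← hfm]
  have : (volume : Measure unitInterval).map Subtype.val = volume.restrict (Set.Icc (0:ℝ) 1) :=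
    (measurePreserving_subtype_coe measurableSet_Icc).map_eq
  rw [← this, Measure.map_map hg measurable_subtype_coe]
  congr 1
  ext x
  simp [g]

end Measures

/-! ### Second order inequalities for powers of the norm -/

section Smoothness

/-- Bernoulli's inequality at `z⁻¹`, multiplied by `z ^ q`: the graph lies above its tangent at `z`.
-/
lemma rpow_sub_one_le {q z : ℝ} (hq : 1 ≤ q) (hz : 0 < z) :
    z ^ q - 1 ≤ q * z ^ (q - 1) * (z - 1) := by
  have h := one_add_mul_self_le_rpow_one_add (s := z⁻¹ - 1) (by linarith [inv_pos.2 hz]) hq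
  rw [add_sub_cancel, Real.inv_rpow hz.le] at h
  have hzq : 0 < z ^ q := Real.rpow_pos_of_pos hz q
  have h2 := mul_le_mul_of_nonneg_left h hzq.le
  rw [mul_inv_cancel₀ hzq.ne'] at h2
  have h3 : z ^ q * z⁻¹ = z ^ (q - 1) := by rw [Real.rpow_sub_one hz.ne', div_eq_mul_inv]
  have h4 : z ^ (q - 1) * z = z ^ q := by rw [← h3, mul_assoc, inv_mul_cancel₀ hz.ne', mul_one]
  nlinarith

/-- A second order upper bound of `z ^ q` near `1`. -/
lemma exists_rpow_le_quadratic {q : ℝ} (hq : 1 ≤ q) :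
    ∃ K : ℝ, 0 ≤ K ∧ ∀ z : ℝ, 0 ≤ z → z ≤ 4 → z ^ q ≤ 1 + q * (z - 1) + K * (z - 1) ^ 2 := by
  have h4 : (1 : ℝ) ≤ 4 ^ (q - 1) := Real.one_le_rpow (by norm_num) (by linarith)
  refine ⟨q * (q * 4 ^ (q - 1)), by positivity, fun z hz hz4 => ?_⟩
  have hqq : q ≤ q * (q * 4 ^ (q - 1)) := by
    have : 1 ≤ q * 4 ^ (q - 1) := one_le_mul_of_one_le_of_one_le hq h4
    nlinarith
  rcases hz.eq_or_lt with rfl | hz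
  · rw [Real.zero_rpow (by linarith)]
    nlinarith
  have h1 := rpow_sub_one_le hq hz
  -- It remains to bound the slope difference linearly in `z - 1`. In both cases `z ^ (q - 1)` is
  -- compared with `z ^ q`, which is closer to a known linear bound, because the exponent `q - 1`
  -- may be below `1`.
  suffices (z ^ (q - 1) - 1) * (z - 1) ≤ q * 4 ^ (q - 1) * (z - 1) ^ 2 by nlinarith
  rcases le_total 1 z with h | h
  · have h2 : z ^ (q - 1) ≤ z ^ q := Real.rpow_le_rpow_of_exponent_le h (by linarith)
    have h3 : z ^ (q - 1) ≤ 4 ^ (q - 1) := Real.rpow_le_rpow hz.le hz4 (by linarith)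
    have h5 : q * z ^ (q - 1) * (z - 1) ≤ q * 4 ^ (q - 1) * (z - 1) := by
      have : 0 ≤ z - 1 := by linarith
      gcongr
    nlinarith
  · have h2 : z ^ q ≤ z ^ (q - 1) := Real.rpow_le_rpow_of_exponent_ge hz h (by linarith)
    have h3 := one_add_mul_self_le_rpow_one_add (s := z - 1) (by linarith) hq
    rw [add_sub_cancel] at h3
    have h5 : q * (z - 1) ^ 2 ≤ q * 4 ^ (q - 1) * (z - 1) ^ 2 := by
      gcongr
      nlinarith
    nlinarith


/-- A second order upper bound of `‖x + y‖ ^ p`. -/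
lemma exists_norm_add_rpow_le {p : ℝ} (hp : 2 ≤ p) :
    ∃ K : ℝ, 0 ≤ K ∧ ∀ (H : Type u) [NormedAddCommGroup H] [InnerProductSpace ℝ H] (x y : H),
      ‖x + y‖ ^ p ≤ ‖x‖ ^ p + p * (‖x‖ ^ (p - 2) * inner ℝ x y) +
        K * (‖x‖ ^ (p - 2) * ‖y‖ ^ 2 + ‖y‖ ^ p) := by
  obtain ⟨K, hK, hKz⟩ := exists_rpow_le_quadratic (q := p / 2) (by linarith)
  have h2p : (0 : ℝ) ≤ 2 ^ p := by positivity
  refine ⟨p + 9 * K + 2 ^ p, by positivity, fun H _ _ x y => ?_⟩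
  have hin : |inner ℝ x y| ≤ ‖x‖ * ‖y‖ := abs_real_inner_le_norm x y
  rw [abs_le] at hin
  have hsq : ‖x + y‖ ^ 2 = ‖x‖ ^ 2 + 2 * inner ℝ x y + ‖y‖ ^ 2 := norm_add_sq_real x y
  have hy := norm_nonneg y
  have hx := norm_nonneg x
  have hA : 0 ≤ ‖x‖ ^ (p - 2) := by positivity
  have hB : 0 ≤ ‖y‖ ^ p := by positivity
  -- If `y` dominates, everything is of size `‖y‖ ^ p`. Otherwise the ratio `z` below is at most
  -- `4`, and the one-variable bound with exponent `p / 2` scales back.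
  rcases lt_or_ge ‖x‖ ‖y‖ with hxy | hxy
  · have h1 : ‖x + y‖ ^ p ≤ 2 ^ p * ‖y‖ ^ p := by
      rw [← Real.mul_rpow (by norm_num) hy]
      exact Real.rpow_le_rpow (norm_nonneg _) (by linarith [norm_add_le x y]) (by linarith)
    have hy0 : 0 < ‖y‖ := hx.trans_lt hxy
    have h2 : ‖x‖ ^ (p - 2) * (‖x‖ * ‖y‖) ≤ ‖y‖ ^ p := by
      calc ‖x‖ ^ (p - 2) * (‖x‖ * ‖y‖) ≤ ‖y‖ ^ (p - 2) * (‖y‖ * ‖y‖) := by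
            gcongr
        _ = ‖y‖ ^ p := by
            rw [← pow_two, ← Real.rpow_natCast, ← Real.rpow_add hy0]
            congr 1
            push_cast
            ring
    have h3 : -(‖y‖ ^ p) ≤ ‖x‖ ^ (p - 2) * inner ℝ x y := by nlinarith
    have h4 : 0 ≤ ‖x‖ ^ p := by positivity
    have h5 : 0 ≤ ‖x‖ ^ (p - 2) * ‖y‖ ^ 2 := by positivity
    have h6 : 0 ≤ (p + 9 * K + 2 ^ p) * (‖x‖ ^ (p - 2) * ‖y‖ ^ 2) := by positivity
    nlinarith [mul_nonneg hK hB]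
  rcases hx.eq_or_lt with h0 | hx0
  · have hy0 : ‖y‖ = 0 := by linarith
    rw [norm_eq_zero] at hy0
    have hx0 : x = 0 := by rw [← norm_eq_zero, h0]
    simp [hy0, hx0, Real.zero_rpow (show p ≠ 0 by linarith)]
  set z := ‖x + y‖ ^ 2 / ‖x‖ ^ 2 with hz
  have hz4 : z ≤ 4 := by
    rw [hz, div_le_iff₀ (by positivity)]
    nlinarith
  have hmul : ∀ w : ℝ, ‖x‖ ^ p * w = ‖x‖ ^ (p - 2) * (‖x‖ ^ 2 * w) := by
    intro w
    rw [← mul_assoc, ← Real.rpow_natCast ‖x‖ 2, ← Real.rpow_add hx0]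
    congr 3
    push_cast
    ring
  have hzx : ‖x‖ ^ 2 * (z - 1) = 2 * inner ℝ x y + ‖y‖ ^ 2 := by
    rw [hz, mul_sub, mul_div_cancel₀ _ (by positivity), hsq]
    ring
  have h1 : ‖x + y‖ ^ p = ‖x‖ ^ p * z ^ (p / 2) := by
    rw [hz, Real.div_rpow (by positivity) (by positivity), ← Real.rpow_natCast ‖x + y‖,
      ← Real.rpow_natCast ‖x‖, ← Real.rpow_mul (norm_nonneg _), ← Real.rpow_mul hx]
    have : ((2 : ℕ) : ℝ) * (p / 2) = p := by push_cast; ring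
    rw [this, mul_div_cancel₀ _ (by positivity)]
  have h2 := mul_le_mul_of_nonneg_left (hKz z (by positivity) hz4)
    (show 0 ≤ ‖x‖ ^ p by positivity)
  have h3 : ‖x‖ ^ 2 * (z - 1) ^ 2 ≤ 9 * ‖y‖ ^ 2 := by
    have h5 : (‖x‖ ^ 2 * (z - 1)) ^ 2 ≤ ‖x‖ ^ 2 * (9 * ‖y‖ ^ 2) := by
      rw [hzx]
      have : |2 * inner ℝ x y + ‖y‖ ^ 2| ≤ 3 * (‖x‖ * ‖y‖) := by
        rw [abs_le]; constructor <;> nlinarith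
      calc (2 * inner ℝ x y + ‖y‖ ^ 2) ^ 2 = |2 * inner ℝ x y + ‖y‖ ^ 2| ^ 2 := (sq_abs _).symm
        _ ≤ (3 * (‖x‖ * ‖y‖)) ^ 2 := by gcongr
        _ = _ := by ring
    have h6 : (‖x‖ ^ 2 * (z - 1)) ^ 2 = ‖x‖ ^ 2 * (‖x‖ ^ 2 * (z - 1) ^ 2) := by ring
    rw [h6] at h5
    exact le_of_mul_le_mul_left h5 (by positivity)
  rw [h1]
  refine h2.trans ?_
  have h4 : ‖x‖ ^ p * (1 + p / 2 * (z - 1) + K * (z - 1) ^ 2) =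
      ‖x‖ ^ p + ‖x‖ ^ (p - 2) * (p / 2 * (‖x‖ ^ 2 * (z - 1)) + K * (‖x‖ ^ 2 * (z - 1) ^ 2)) := by
    have := hmul (p / 2 * (z - 1) + K * (z - 1) ^ 2)
    linear_combination this
  rw [h4, hzx]
  have h5 := mul_le_mul_of_nonneg_left (mul_le_mul_of_nonneg_left h3 hK) hA
  have h7 : 0 ≤ ‖x‖ ^ (p - 2) * ‖y‖ ^ 2 := by positivity
  have h8 : 0 ≤ (p + 9 * K + 2 ^ p) * ‖y‖ ^ p := by positivity
  nlinarith [mul_nonneg h2p h7]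

/-- Converts a bound on `p`-th powers into one on squares. Superadditivity of `x ^ (p / 2)` absorbs
`b ^ p` and Bernoulli absorbs the mixed term, each with coefficient `2 * K + 1`; averaging the two
gives both at once with room to spare. -/
lemma add_mul_le_rpow {p K a b : ℝ} (hp : 2 ≤ p) (hK : 0 ≤ K) (ha : 0 ≤ a) (hb : 0 ≤ b) :
    a ^ p + K * (a ^ (p - 2) * b ^ 2 + b ^ p) ≤ (a ^ 2 + (2 * K + 1) * b ^ 2) ^ (p / 2) := by
  have hpow : ∀ c : ℝ, 0 ≤ c → (c ^ 2) ^ (p / 2) = c ^ p := fun c hc => by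
    rw [← Real.rpow_natCast c, ← Real.rpow_mul hc]
    congr 1
    push_cast
    ring
  have hC1 : 1 ≤ 2 * K + 1 := by linarith
  have hC : 2 * K + 1 ≤ (2 * K + 1) ^ (p / 2) := Real.self_le_rpow_of_one_le hC1 (by linarith)
  have hbp : 0 ≤ b ^ p := by positivity
  have h1 : a ^ p + (2 * K + 1) * b ^ p ≤ (a ^ 2 + (2 * K + 1) * b ^ 2) ^ (p / 2) := by
    have := Real.add_rpow_le_rpow_add (p := p / 2) (sq_nonneg a)
      (show 0 ≤ (2 * K + 1) * b ^ 2 by positivity) (by linarith)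
    rw [hpow a ha, Real.mul_rpow (by positivity) (by positivity), hpow b hb] at this
    nlinarith
  rcases ha.eq_or_lt with rfl | ha
  · have h0 : (0 : ℝ) ^ (p - 2) * b ^ 2 ≤ b ^ p := by
      rcases hp.eq_or_lt with rfl | hp
      · simp
      · rw [Real.zero_rpow (by linarith)]
        simpa
    nlinarith
  have h2 : a ^ p + (2 * K + 1) * (a ^ (p - 2) * b ^ 2) ≤
      (a ^ 2 + (2 * K + 1) * b ^ 2) ^ (p / 2) := by
    have hs : 0 ≤ (2 * K + 1) * b ^ 2 / a ^ 2 := by positivity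
    have h3 := one_add_mul_self_le_rpow_one_add (s := (2 * K + 1) * b ^ 2 / a ^ 2)
      (p := p / 2) (by linarith) (by linarith)
    have h4 : a ^ 2 + (2 * K + 1) * b ^ 2 = a ^ 2 * (1 + (2 * K + 1) * b ^ 2 / a ^ 2) := by
      rw [mul_add, mul_one, mul_div_cancel₀ _ (by positivity)]
    rw [h4, Real.mul_rpow (by positivity) (by positivity), hpow a ha.le]
    have h5 : a ^ p * ((2 * K + 1) * b ^ 2 / a ^ 2) = (2 * K + 1) * (a ^ (p - 2) * b ^ 2) := by
      rw [Real.rpow_sub ha, ← Real.rpow_natCast a 2]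
      push_cast
      ring
    have h6 := mul_le_mul_of_nonneg_left h3 (show 0 ≤ a ^ p by positivity)
    have h7 : 0 ≤ (2 * K + 1) * (a ^ (p - 2) * b ^ 2) := by positivity
    nlinarith
  have h7 : 0 ≤ a ^ (p - 2) * b ^ 2 := by positivity
  nlinarith

end Smoothness

/-! ### 2-smoothness of `L^p(Ω; H)` for martingale differences -/

section Martingale

lemma integral_rpow_norm_eq {p : ℝ≥0} (hp : 2 ≤ p) {H Ω : Type*} [NormedAddCommGroup H]
    [MeasurableSpace Ω] {P : Measure Ω} {X : Ω → H} (hX : MemLp X p P) :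
    ∫ ω, ‖X ω‖ ^ (p : ℝ) ∂P = (eLpNorm X p P).toReal ^ (p : ℝ) := by
  have hp0 : p ≠ 0 := (zero_lt_two.trans_le hp).ne'
  have h := hX.eLpNorm_eq_integral_rpow_norm (by simpa using hp0) ENNReal.coe_ne_top
  have h0 : 0 ≤ ∫ ω, ‖X ω‖ ^ (p : ℝ) ∂P := integral_nonneg fun _ => by positivity
  simp only [ENNReal.coe_toReal] at h
  rw [h, ENNReal.toReal_ofReal (by positivity), ← Real.rpow_mul h0,
    inv_mul_cancel₀ (by exact_mod_cast hp0), Real.rpow_one]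

lemma integrable_rpow_norm {p : ℝ≥0} (hp : 2 ≤ p) {H Ω : Type*} [NormedAddCommGroup H]
    [MeasurableSpace Ω] {P : Measure Ω} {X : Ω → H} (hX : MemLp X p P) :
    Integrable (fun ω => ‖X ω‖ ^ (p : ℝ)) P := by
  have hp0 : p ≠ 0 := (zero_lt_two.trans_le hp).ne'
  exact hX.integrable_norm_rpow (by simpa using hp0) ENNReal.coe_ne_top

lemma rpow_sub_two_mul_le {p a b : ℝ} (hp : 2 ≤ p) (ha : 0 ≤ a) (hb : 0 ≤ b) :
    a ^ (p - 2) * b ^ 2 ≤ a ^ p + b ^ p := by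
  have key : ∀ c : ℝ, 0 ≤ c → c ^ (p - 2) * c ^ 2 ≤ c ^ p := by
    intro c hc
    rcases hc.eq_or_lt with rfl | hc
    · simp
      positivity
    · rw [← Real.rpow_natCast c 2, ← Real.rpow_add hc]
      apply le_of_eq; congr 1; norm_num
  have ha' : 0 ≤ a ^ p := by positivity
  have hb' : 0 ≤ b ^ p := by positivity
  rcases le_total a b with h | h
  · calc a ^ (p - 2) * b ^ 2 ≤ b ^ (p - 2) * b ^ 2 := by gcongr
      _ ≤ b ^ p := key b hb
      _ ≤ _ := by linarith
  · calc a ^ (p - 2) * b ^ 2 ≤ a ^ (p - 2) * a ^ 2 := by gcongr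
      _ ≤ a ^ p := key a ha
      _ ≤ _ := by linarith

lemma integrable_rpow_mul_sq {p : ℝ≥0} (hp : 2 ≤ p) {H Ω : Type*} [NormedAddCommGroup H]
    [MeasurableSpace Ω] {P : Measure Ω} {X Y : Ω → H} (hX : MemLp X p P) (hY : MemLp Y p P) :
    Integrable (fun ω => ‖X ω‖ ^ ((p : ℝ) - 2) * ‖Y ω‖ ^ 2) P := by
  have hp' : (2 : ℝ) ≤ p := by exact_mod_cast hp
  refine ((integrable_rpow_norm hp hX).add (integrable_rpow_norm hp hY)).mono' ?_ ?_
  · have h1 := (hX.1.norm.aemeasurable.pow_const ((p : ℝ) - 2)).aestronglyMeasurable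
    exact h1.mul (hY.1.norm.pow 2)
  · refine ae_of_all _ fun ω => ?_
    rw [Real.norm_of_nonneg (by positivity)]
    exact rpow_sub_two_mul_le hp' (norm_nonneg _) (norm_nonneg _)

/-- Hölder with weights `(p - 2) / p` and `2 / p`, in a form that includes `p = 2`. -/
lemma integral_rpow_mul_sq_le {p : ℝ≥0} (hp : 2 ≤ p) {H Ω : Type*} [NormedAddCommGroup H]
    [MeasurableSpace Ω] {P : Measure Ω} {X Y : Ω → H} (hX : MemLp X p P) (hY : MemLp Y p P) :
    ∫ ω, ‖X ω‖ ^ ((p : ℝ) - 2) * ‖Y ω‖ ^ 2 ∂P ≤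
      (eLpNorm X p P).toReal ^ ((p : ℝ) - 2) * (eLpNorm Y p P).toReal ^ 2 := by
  have hp' : (2 : ℝ) ≤ p := by exact_mod_cast hp
  have hp0 : p ≠ 0 := (zero_lt_two.trans_le hp).ne'
  have hpr : (p : ℝ) ≠ 0 := by exact_mod_cast hp0
  have hpe : (p : ℝ≥0∞) ≠ 0 := by exact_mod_cast hp0
  have h := ENNReal.lintegral_mul_norm_pow_le (μ := P) (p := ((p : ℝ) - 2) / p) (q := 2 / p)
    (hX.1.enorm.pow_const (p : ℝ)) (hY.1.enorm.pow_const (p : ℝ))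
    (div_nonneg (by linarith) (by linarith)) (by positivity) (by field_simp; ring)
  rw [integral_eq_lintegral_of_nonneg_ae (ae_of_all _ fun ω => by positivity)
    (integrable_rpow_mul_sq hp hX hY).1]
  simp only [← ENNReal.rpow_mul, mul_div_cancel₀ _ hpr] at h
  rw [show (eLpNorm X p P).toReal ^ ((p : ℝ) - 2) * (eLpNorm Y p P).toReal ^ 2 =
    (eLpNorm X p P ^ ((p : ℝ) - 2) * eLpNorm Y p P ^ (2 : ℝ)).toReal by
      rw [ENNReal.toReal_mul, ENNReal.toReal_rpow, ← ENNReal.toReal_pow]; norm_cast]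
  refine ENNReal.toReal_mono (ENNReal.mul_ne_top
    (ENNReal.rpow_ne_top_of_nonneg (by linarith) hX.eLpNorm_ne_top)
    (ENNReal.rpow_ne_top_of_nonneg (by norm_num) hY.eLpNorm_ne_top)) ?_
  refine le_trans (le_of_eq ?_) (h.trans (le_of_eq ?_))
  · refine lintegral_congr fun ω => ?_
    rw [ENNReal.ofReal_mul (by positivity), ← ENNReal.ofReal_rpow_of_nonneg (norm_nonneg _)
      (by linarith), ofReal_norm, ENNReal.ofReal_pow (norm_nonneg _), ofReal_norm]
    norm_cast
  · rw [eLpNorm_eq_lintegral_rpow_enorm_toReal hpe ENNReal.coe_ne_top,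
      eLpNorm_eq_lintegral_rpow_enorm_toReal hpe ENNReal.coe_ne_top, ← ENNReal.rpow_mul,
      ← ENNReal.rpow_mul, ENNReal.coe_toReal, one_div_mul_eq_div, one_div_mul_eq_div]

/-- `K` is a constant of 2-smoothness of `L^p(Ω; H)` along martingale differences. -/
def IsSmoothConst (p : ℝ≥0) (K : ℝ) (H : Type*) [NormedAddCommGroup H] [InnerProductSpace ℝ H]
    [CompleteSpace H] (Ω : Type*) : Prop :=
  ∀ (m mΩ : MeasurableSpace Ω) (P : Measure Ω) [IsProbabilityMeasure P]
    (X Y : Ω → H), m ≤ mΩ → StronglyMeasurable[m] X → MemLp X p P → MemLp Y p P →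
    P[Y | m] =ᵐ[P] 0 →
    (eLpNorm (X + Y) p P).toReal ^ 2 ≤
      (eLpNorm X p P).toReal ^ 2 + K * (eLpNorm Y p P).toReal ^ 2

/-- Integrate the second order expansion of `‖X + Y‖ ^ p`. Its linear term has zero mean, since `‖X‖
^ (p - 2) • X` is measurable for `m` and `Y` has zero conditional mean. The constant is chosen
before the spaces and depends on `p` only. -/
lemma exists_isSmoothConst {p : ℝ≥0} (hp : 2 ≤ p) :
    ∃ K : ℝ, 0 ≤ K ∧ ∀ (H : Type u) [NormedAddCommGroup H] [InnerProductSpace ℝ H]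
      [CompleteSpace H] (Ω : Type v), IsSmoothConst p K H Ω := by
  have hp' : (2 : ℝ) ≤ p := by exact_mod_cast hp
  obtain ⟨K, hK, hKle⟩ := exists_norm_add_rpow_le.{u} hp'
  refine ⟨2 * K + 1, by positivity, fun H _ _ _ Ω m mΩ P _ X Y hm hXm hX hY hce => ?_⟩
  have h1p : (1 : ℝ≥0∞) ≤ p := by exact_mod_cast (one_le_two.trans hp)
  have hXY := hX.add hY
  have hiX := integrable_rpow_norm hp hX
  have hiY := integrable_rpow_norm hp hY
  have hi2 := integrable_rpow_mul_sq hp hX hY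
  have hZm : StronglyMeasurable[m] fun ω => ‖X ω‖ ^ ((p : ℝ) - 2) • X ω :=
    (hXm.norm.measurable.pow_const ((p : ℝ) - 2)).stronglyMeasurable.smul hXm
  have hiZ : Integrable (fun ω => inner ℝ (‖X ω‖ ^ ((p : ℝ) - 2) • X ω) (Y ω)) P := by
    refine ((hiX.add (integrable_rpow_mul_sq hp hX hX)).add hi2).mono'
      ((hZm.mono hm).aestronglyMeasurable.inner hY.1) (ae_of_all _ fun ω => ?_)
    have h1 : |inner ℝ (X ω) (Y ω)| ≤ ‖X ω‖ * ‖Y ω‖ := abs_real_inner_le_norm _ _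
    have h2 : 0 ≤ ‖X ω‖ ^ ((p : ℝ) - 2) := by positivity
    have h3 : 0 ≤ ‖X ω‖ ^ (p : ℝ) := by positivity
    rw [real_inner_smul_left, Real.norm_eq_abs, abs_mul, abs_of_nonneg h2]
    have h4 : |inner ℝ (X ω) (Y ω)| ≤ ‖X ω‖ ^ 2 + ‖Y ω‖ ^ 2 := by
      nlinarith [sq_nonneg (‖X ω‖ - ‖Y ω‖), sq_nonneg (‖X ω‖ + ‖Y ω‖)]
    have h5 := mul_le_mul_of_nonneg_left h4 h2
    simp only [Pi.add_apply]
    nlinarith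
  have hzero : ∫ ω, inner ℝ (‖X ω‖ ^ ((p : ℝ) - 2) • X ω) (Y ω) ∂P = 0 := by
    have h := condExp_bilin_of_stronglyMeasurable_left (innerSL ℝ (E := H)) hZm
      hiZ (hY.integrable h1p)
    rw [← integral_condExp hm]
    refine (integral_congr_ae (h.trans ?_)).trans (integral_zero _ _)
    filter_upwards [hce] with ω hω
    simp [hω]
  have hint : ∫ ω, ‖X ω + Y ω‖ ^ (p : ℝ) ∂P ≤ ∫ ω, ‖X ω‖ ^ (p : ℝ) ∂P +
      p * ∫ ω, inner ℝ (‖X ω‖ ^ ((p : ℝ) - 2) • X ω) (Y ω) ∂P +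
      K * (∫ ω, ‖X ω‖ ^ ((p : ℝ) - 2) * ‖Y ω‖ ^ 2 ∂P + ∫ ω, ‖Y ω‖ ^ (p : ℝ) ∂P) := by
    have e : ∫ ω, (‖X ω‖ ^ (p : ℝ) + p * inner ℝ (‖X ω‖ ^ ((p : ℝ) - 2) • X ω) (Y ω) +
        K * (‖X ω‖ ^ ((p : ℝ) - 2) * ‖Y ω‖ ^ 2 + ‖Y ω‖ ^ (p : ℝ))) ∂P = _ :=
      integral_add (hiX.add (hiZ.const_mul _)) ((hi2.add hiY).const_mul _)
    rw [integral_add hiX (hiZ.const_mul _), integral_const_mul, integral_const_mul,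
      integral_add hi2 hiY] at e
    rw [← e]
    refine integral_mono (integrable_rpow_norm hp hXY)
      ((hiX.add (hiZ.const_mul _)).add ((hi2.add hiY).const_mul _)) fun ω => ?_
    have := hKle H (X ω) (Y ω)
    simpa only [Pi.add_apply, real_inner_smul_left] using this
  have e1 := integral_rpow_norm_eq hp hXY
  simp only [Pi.add_apply] at e1
  rw [hzero, mul_zero, add_zero, e1, integral_rpow_norm_eq hp hX, integral_rpow_norm_eq hp hY]
    at hint
  set a := (eLpNorm X p P).toReal with ha
  set b := (eLpNorm Y p P).toReal with hb
  set c := (eLpNorm (X + Y) p P).toReal with hc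
  have ha0 : 0 ≤ a := ENNReal.toReal_nonneg
  have hb0 : 0 ≤ b := ENNReal.toReal_nonneg
  have hc0 : 0 ≤ c := ENNReal.toReal_nonneg
  have h1 : c ^ (p : ℝ) ≤ (a ^ 2 + (2 * K + 1) * b ^ 2) ^ ((p : ℝ) / 2) := by
    refine (hint.trans ?_).trans (add_mul_le_rpow hp' hK ha0 hb0)
    gcongr
    exact integral_rpow_mul_sq_le hp hX hY
  have h3 : (c ^ 2) ^ ((p : ℝ) / 2) = c ^ (p : ℝ) := by
    rw [← Real.rpow_natCast c, ← Real.rpow_mul hc0]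
    congr 1
    push_cast
    ring
  rw [← h3] at h1
  exact (Real.rpow_le_rpow_iff (by positivity) (by positivity) (by linarith)).1 h1

end Martingale

/-! ### One step of the scheme: growth and sewing -/

section OneStep

/-- The martingale bound `b`, of order `h ^ (1 / 2)`, enters squared, so every term is linear in
`h`. The form `1 + x ^ 2` makes the bound multiplicative and ready for iteration. -/
lemma one_add_sq_le_of_growth {x y a b L h T K : ℝ} (hx : 0 ≤ x) (ha0 : 0 ≤ a) (hb0 : 0 ≤ b)
    (hL : 0 ≤ L) (hK : 0 ≤ K) (hh : 0 ≤ h) (hhT : h ≤ T)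
    (hy : y ^ 2 ≤ (x + a) ^ 2 + K * b ^ 2)
    (ha : a ≤ L * h * (1 + x)) (hb : b ≤ L * h ^ (1 / 2 : ℝ) * (1 + x)) :
    1 + y ^ 2 ≤ (1 + x ^ 2) * (1 + (3 * L + 2 * L ^ 2 * T + 2 * K * L ^ 2) * h) := by
  have hT0 : 0 ≤ T := hh.trans hhT
  have hsq : (1 + x) ^ 2 ≤ 2 * (1 + x ^ 2) := by nlinarith [sq_nonneg (1 - x)]
  have hh2 : (h ^ (1 / 2 : ℝ)) ^ 2 = h := by rw [← Real.sqrt_eq_rpow, Real.sq_sqrt hh]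
  have h1 : b ^ 2 ≤ L ^ 2 * h * (2 * (1 + x ^ 2)) := by
    calc b ^ 2 ≤ (L * h ^ (1 / 2 : ℝ) * (1 + x)) ^ 2 := by gcongr
      _ = L ^ 2 * h * (1 + x) ^ 2 := by rw [mul_pow, mul_pow, hh2]
      _ ≤ _ := by gcongr
  have h2 : a ^ 2 ≤ L ^ 2 * T * h * (2 * (1 + x ^ 2)) := by
    calc a ^ 2 ≤ (L * h * (1 + x)) ^ 2 := by gcongr
      _ = L ^ 2 * h * h * (1 + x) ^ 2 := by ring
      _ ≤ L ^ 2 * T * h * (2 * (1 + x ^ 2)) := by gcongr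
  have h3 : 2 * x * a ≤ 3 * L * h * (1 + x ^ 2) := by
    calc 2 * x * a ≤ 2 * x * (L * h * (1 + x)) := by gcongr
      _ = L * h * (2 * x + 2 * x ^ 2) := by ring
      _ ≤ L * h * (3 * (1 + x ^ 2)) := by
        gcongr
        nlinarith [sq_nonneg (1 - x)]
      _ = _ := by ring
  have h4 := mul_le_mul_of_nonneg_left h1 hK
  nlinarith

lemma sq_le_of_sewing {d d' a b C h T K E : ℝ} (hd : 0 ≤ d) (ha0 : 0 ≤ a) (hb0 : 0 ≤ b)
    (hC : 0 ≤ C) (hK : 0 ≤ K) (hh : 0 ≤ h) (hhT : h ≤ T)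
    (hy : d' ^ 2 ≤ (d + a) ^ 2 + K * b ^ 2)
    (ha : a ≤ C * h * (d + E)) (hb : b ≤ C * h ^ (1 / 2 : ℝ) * (d + E)) :
    d' ^ 2 ≤ d ^ 2 * (1 + (3 * C + 2 * C ^ 2 * T + 2 * K * C ^ 2) * h) +
      (3 * C + 2 * C ^ 2 * T + 2 * K * C ^ 2) * h * E ^ 2 := by
  have hT0 : 0 ≤ T := hh.trans hhT
  have hsq : (d + E) ^ 2 ≤ 2 * (d ^ 2 + E ^ 2) := by nlinarith [sq_nonneg (d - E)]
  have hh2 : (h ^ (1 / 2 : ℝ)) ^ 2 = h := by rw [← Real.sqrt_eq_rpow, Real.sq_sqrt hh]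
  have h1 : b ^ 2 ≤ C ^ 2 * h * (2 * (d ^ 2 + E ^ 2)) := by
    calc b ^ 2 ≤ (C * h ^ (1 / 2 : ℝ) * (d + E)) ^ 2 := by gcongr
      _ = C ^ 2 * h * (d + E) ^ 2 := by rw [mul_pow, mul_pow, hh2]
      _ ≤ _ := by gcongr
  have h2 : a ^ 2 ≤ C ^ 2 * T * h * (2 * (d ^ 2 + E ^ 2)) := by
    calc a ^ 2 ≤ (C * h * (d + E)) ^ 2 := by gcongr
      _ = C ^ 2 * h * h * (d + E) ^ 2 := by ring
      _ ≤ C ^ 2 * T * h * (2 * (d ^ 2 + E ^ 2)) := by gcongr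
  have h3 : 2 * d * a ≤ 3 * C * h * (d ^ 2 + E ^ 2) := by
    calc 2 * d * a ≤ 2 * d * (C * h * (d + E)) := by gcongr
      _ = C * h * (2 * d ^ 2 + 2 * d * E) := by ring
      _ ≤ C * h * (3 * (d ^ 2 + E ^ 2)) := by
        gcongr
        nlinarith [sq_nonneg (d - E), sq_nonneg E]
      _ = _ := by ring
  have h4 := mul_le_mul_of_nonneg_left h1 hK
  nlinarith

variable {p : ℝ≥0} {H : Type*} [NormedAddCommGroup H] [InnerProductSpace ℝ H] [CompleteSpace H]
  {Ω : Type*} {mΩ : MeasurableSpace Ω} {ℱ : Filtration ℝ≥0 mΩ} {P : Measure Ω}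
  [IsProbabilityMeasure P]

lemma stronglyMeasurable_hatInc (s : ℝ≥0) (X Y : Ω → H) :
    StronglyMeasurable[ℱ s] (hatInc ℱ P s X Y) := stronglyMeasurable_condExp

lemma memLp_hatInc (hp : 1 ≤ p) {s : ℝ≥0} {X Y : Ω → H} (hX : MemLp X p P) (hY : MemLp Y p P) :
    MemLp (hatInc ℱ P s X Y) p P := (hY.sub hX).condExp (by exact_mod_cast hp)

lemma memLp_tildeInc (hp : 1 ≤ p) {s : ℝ≥0} {X Y : Ω → H} (hX : MemLp X p P)
    (hY : MemLp Y p P) : MemLp (tildeInc ℱ P s X Y) p P :=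
  (hY.sub hX).sub (memLp_hatInc hp hX hY)

lemma condExp_tildeInc (hp : 1 ≤ p) {s : ℝ≥0} {X Y : Ω → H} (hX : MemLp X p P)
    (hY : MemLp Y p P) : P[tildeInc ℱ P s X Y | ℱ s] =ᵐ[P] 0 := by
  have hp' : (1 : ℝ≥0∞) ≤ p := by exact_mod_cast hp
  have h := condExp_sub ((hY.sub hX).integrable hp')
    ((memLp_hatInc (ℱ := ℱ) (s := s) hp hX hY).integrable hp') (ℱ s)
  refine h.trans ?_
  rw [condExp_of_stronglyMeasurable (ℱ.le s) (stronglyMeasurable_hatInc s X Y)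
    ((memLp_hatInc (ℱ := ℱ) (s := s) hp hX hY).integrable hp')]
  exact Eventually.of_forall fun ω => by simp [hatInc]

/-- The conditional mean `A` is known at time `s`, so it joins `X` by the triangle inequality; only
`B` is treated as a martingale difference. -/
lemma IsSmoothConst.add_add {K : ℝ} (hK : IsSmoothConst p K H Ω) (hp : 1 ≤ p) {s : ℝ≥0}
    {X A B : Ω → H} (hXm : StronglyMeasurable[ℱ s] X) (hX : MemLp X p P)
    (hAm : StronglyMeasurable[ℱ s] A) (hA : MemLp A p P) (hB : MemLp B p P)
    (hBc : P[B | ℱ s] =ᵐ[P] 0) :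
    (eLpNorm (X + A + B) p P).toReal ^ 2 ≤
      ((eLpNorm X p P).toReal + (eLpNorm A p P).toReal) ^ 2 +
        K * (eLpNorm B p P).toReal ^ 2 := by
  have hp' : (1 : ℝ≥0∞) ≤ p := by exact_mod_cast hp
  refine (hK (ℱ s) mΩ P (X + A) B (ℱ.le s) (hXm.add hAm) (hX.add hA) hB hBc).trans ?_
  gcongr
  rw [← ENNReal.toReal_add hX.eLpNorm_ne_top hA.eLpNorm_ne_top]
  exact ENNReal.toReal_mono (ENNReal.add_ne_top.2 ⟨hX.eLpNorm_ne_top, hA.eLpNorm_ne_top⟩)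
    (eLpNorm_add_le hX.1 hA.1 hp')

variable [SecondCountableTopology H] [MeasurableSpace H] [BorelSpace H]
  {Θ : ℝ≥0 → ℝ≥0 → PSpace p H → PSpace p H} {β : ℝ} {L C : ℝ≥0}
  {𝒳 : ∀ s _r t : ℝ≥0, LpAt H p ℱ P s × LpAt H p ℱ P s → LpAt H p ℱ P t × LpAt H p ℱ P t}

lemma LpAt.measurable {s : ℝ≥0} (X : LpAt H p ℱ P s) : Measurable X.1 :=
  X.2.1.mono (ℱ.le s) le_rfl

/-- `‖μ‖_p` as a real number. -/
noncomputable def PSpace.nrm (μ : PSpace p H) : ℝ := μ.norm.toReal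

lemma PSpace.nrm_nonneg (μ : PSpace p H) : 0 ≤ μ.nrm := ENNReal.toReal_nonneg

lemma PSpace.ofReal_nrm (μ : PSpace p H) : ENNReal.ofReal μ.nrm = μ.norm :=
  ENNReal.ofReal_toReal μ.norm_ne_top

/-- The uniform variable is measurable at time `0`, so the pair is admissible at every `s`. -/
lemma exists_pair_of_isCoupling (hA : Atomless ℱ P) (s : ℝ≥0) {μ ν : PSpace p H}
    {Γ : Measure (H × H)} (hΓ : IsCoupling μ.toMeasure ν.toMeasure Γ) :
    ∃ X : LpAt H p ℱ P s × LpAt H p ℱ P s, P.map X.1.1 = μ.toMeasure ∧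
      P.map X.2.1 = ν.toMeasure ∧
      eLpNorm (X.1.1 - X.2.1) p P = eLpNorm (fun z : H × H => z.1 - z.2) p Γ := by
  have := hΓ.isProbabilityMeasure
  obtain ⟨Z, hZ, hZΓ⟩ := exists_map_eq_of_atomless hA Γ
  have hZ' : Measurable Z := hZ.mono (ℱ.le 0) le_rfl
  have h1 : P.map (fun ω => (Z ω).1) = μ.toMeasure := by
    rw [← hΓ.1, ← hZΓ, Measure.map_map (by fun_prop) (by fun_prop)]; rfl
  have h2 : P.map (fun ω => (Z ω).2) = ν.toMeasure := by
    rw [← hΓ.2, ← hZΓ, Measure.map_map (by fun_prop) (by fun_prop)]; rfl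
  refine ⟨(⟨fun ω => (Z ω).1, (measurable_fst.comp hZ).mono (ℱ.mono zero_le) le_rfl,
    memLp_of_map_eq (by fun_prop) h1⟩, ⟨fun ω => (Z ω).2,
    (measurable_snd.comp hZ).mono (ℱ.mono zero_le) le_rfl,
    memLp_of_map_eq (by fun_prop) h2⟩), h1, h2, ?_⟩
  rw [← hZΓ, eLpNorm_map_measure (by fun_prop) (by fun_prop)]
  rfl

lemma isCoupling_diag (μ : PSpace p H) :
    IsCoupling μ.toMeasure μ.toMeasure (μ.toMeasure.map fun x => (x, x)) := by
  constructor <;> rw [Measure.map_map (by fun_prop) (by fun_prop)] <;> exact Measure.map_id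

/-- The growth constant of a scheme on `[0, T]`. -/
noncomputable def stepConst (L T K : ℝ) : ℝ := 3 * L + 2 * L ^ 2 * T + 2 * K * L ^ 2

lemma stepConst_nonneg {L T K : ℝ} (hL : 0 ≤ L) (hT : 0 ≤ T) (hK : 0 ≤ K) :
    0 ≤ stepConst L T K := by
  unfold stepConst; positivity

/-- The operator is applied with `r = t` to a pair on the diagonal; only the first output is used.
-/
lemma IsCouplingFamily.one_add_nrm_sq_le (h𝒳 : IsCouplingFamily ℱ P Θ β L C 𝒳)
    (hp : 1 ≤ p) (hA : Atomless ℱ P) {K : ℝ} (hK0 : 0 ≤ K) (hK : IsSmoothConst p K H Ω)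
    {s t T : ℝ≥0} (hst : s ≤ t) (hT : t ≤ T) (μ : PSpace p H) :
    1 + (Θ s t μ).nrm ^ 2 ≤ (1 + μ.nrm ^ 2) * (1 + stepConst L T K * ((t : ℝ) - s)) := by
  obtain ⟨X, hX1, hX2, -⟩ := exists_pair_of_isCoupling hA s (isCoupling_diag μ)
  set Y := 𝒳 s t t X with hY
  have hY1 := h𝒳.repr_one s t t hst le_rfl μ μ X hX1 hX2
  have hg := h𝒳.growth_hat s t t hst le_rfl X
  have hg' := h𝒳.growth_tilde s t t hst le_rfl X
  rw [← hY] at hY1 hg hg'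
  have hsm := hK.add_add hp X.1.2.1.stronglyMeasurable X.1.2.2
    (stronglyMeasurable_hatInc (ℱ := ℱ) (P := P) s X.1.1 Y.1.1) (memLp_hatInc hp X.1.2.2 Y.1.2.2)
    (memLp_tildeInc hp X.1.2.2 Y.1.2.2) (condExp_tildeInc hp X.1.2.2 Y.1.2.2)
  rw [show X.1.1 + hatInc ℱ P s X.1.1 Y.1.1 + tildeInc ℱ P s X.1.1 Y.1.1 = Y.1.1 by
    simp only [tildeInc]; abel] at hsm
  have htop : (1 : ℝ≥0∞) + eLpNorm X.1.1 p P ≠ ∞ :=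
    ENNReal.add_ne_top.2 ⟨by simp, X.1.2.2.eLpNorm_ne_top⟩
  have hg := ENNReal.toReal_mono (ENNReal.mul_ne_top ENNReal.coe_ne_top htop) hg
  have hg' := ENNReal.toReal_mono (ENNReal.mul_ne_top ENNReal.coe_ne_top htop) hg'
  rw [ENNReal.toReal_mul, ENNReal.toReal_add (by simp) X.1.2.2.eLpNorm_ne_top,
    ENNReal.coe_toReal, ENNReal.toReal_one] at hg hg'
  rw [eLpNorm_eq_of_map_eq Y.1.measurable hY1, eLpNorm_eq_of_map_eq X.1.measurable hX1] at hsm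
  rw [eLpNorm_eq_of_map_eq X.1.measurable hX1] at hg hg'
  push_cast [NNReal.coe_sub hst] at hg hg'
  have h0 : (0 : ℝ) ≤ t - s := by simpa using hst
  exact one_add_sq_le_of_growth μ.nrm_nonneg ENNReal.toReal_nonneg ENNReal.toReal_nonneg
    L.2 hK0 h0 ((sub_le_self _ s.2).trans hT) hsm hg hg'

/-- `μ` and `ν` are represented at time `s` by random variables whose squared `L^p`-distance is
at most `q`. -/
def Coupled (ℱ : Filtration ℝ≥0 mΩ) (P : Measure Ω) (s : ℝ≥0) (μ ν : PSpace p H) (q : ℝ) : Prop :=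
  ∃ X : LpAt H p ℱ P s × LpAt H p ℱ P s, P.map X.1.1 = μ.toMeasure ∧ P.map X.2.1 = ν.toMeasure ∧
    (eLpNorm (X.1.1 - X.2.1) p P).toReal ^ 2 ≤ q

lemma Coupled.W_le {s : ℝ≥0} {μ ν : PSpace p H} {q : ℝ} (h : Coupled ℱ P s μ ν q) :
    W μ ν ≤ ENNReal.ofReal (Real.sqrt q) := by
  obtain ⟨X, h1, h2, hq⟩ := h
  refine (W_le_of_map X.1.measurable X.2.measurable h1 h2).trans ?_
  rw [← ENNReal.ofReal_toReal (X.1.2.2.sub X.2.2.2).eLpNorm_ne_top]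
  exact ENNReal.ofReal_le_ofReal (Real.le_sqrt_of_sq_le hq)

/-- The output of `𝒳` is again an admissible pair, now at time `t`, representing one step on the
left and two steps on the right. `S` and `h` stand for bounds uniform over all steps, which keeps
the recursion linear. -/
lemma IsCouplingFamily.coupled_step (h𝒳 : IsCouplingFamily ℱ P Θ β L C 𝒳)
    (hp : 1 ≤ p) (hβ : 0 ≤ β) {K : ℝ} (hK0 : 0 ≤ K) (hK : IsSmoothConst p K H Ω)
    {s r t T : ℝ≥0} (hsr : s ≤ r) (hrt : r ≤ t) (hT : t ≤ T) {μ ν : PSpace p H} {q S h : ℝ}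
    (hS : 1 + (μ.nrm + ν.nrm) ≤ S) (hh : (t : ℝ) - s ≤ h) (hc : Coupled ℱ P s μ ν q) :
    Coupled ℱ P t (Θ s t μ) (Θ r t (Θ s r ν))
      (q * (1 + stepConst C T K * ((t : ℝ) - s)) +
        stepConst C T K * ((t : ℝ) - s) * (S * h ^ β) ^ 2) := by
  obtain ⟨X, hX1, hX2, hq⟩ := hc
  have hst := hsr.trans hrt
  have h0 : (0 : ℝ) ≤ t - s := by simpa using hst
  set Y := 𝒳 s r t X with hY
  refine ⟨Y, h𝒳.repr_one s r t hsr hrt μ ν X hX1 hX2, h𝒳.repr_two s r t hsr hrt μ ν X hX1 hX2, ?_⟩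
  have hg := h𝒳.sewing_hat s r t hsr hrt X
  have hg' := h𝒳.sewing_tilde s r t hsr hrt X
  rw [← hY] at hg hg'
  have hD := X.1.2.2.sub X.2.2.2
  have hm2 := (X.2.2.2.sub X.1.2.2)
  have hh1 := memLp_hatInc (ℱ := ℱ) (s := s) hp X.1.2.2 Y.1.2.2
  have hh2 := memLp_hatInc (ℱ := ℱ) (s := s) hp X.2.2.2 Y.2.2.2
  have ht1 := memLp_tildeInc (ℱ := ℱ) (s := s) hp X.1.2.2 Y.1.2.2
  have ht2 := memLp_tildeInc (ℱ := ℱ) (s := s) hp X.2.2.2 Y.2.2.2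
  have hp' : (1 : ℝ≥0∞) ≤ p := by exact_mod_cast hp
  -- The new difference is the old one, plus the difference of the conditional means, plus a
  -- martingale difference.
  have hsm := hK.add_add hp
    (X.2.2.1.stronglyMeasurable.sub X.1.2.1.stronglyMeasurable) hm2
    ((stronglyMeasurable_hatInc (ℱ := ℱ) (P := P) s X.2.1 Y.2.1).sub
      (stronglyMeasurable_hatInc (ℱ := ℱ) (P := P) s X.1.1 Y.1.1)) (hh2.sub hh1) (ht2.sub ht1)
    (by
      refine (condExp_sub (ht2.integrable hp') (ht1.integrable hp') (ℱ s)).trans ?_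
      filter_upwards [condExp_tildeInc (ℱ := ℱ) (s := s) hp X.1.2.2 Y.1.2.2,
        condExp_tildeInc (ℱ := ℱ) (s := s) hp X.2.2.2 Y.2.2.2] with ω e1 e2
      simp [e1, e2])
  rw [show X.2.1 - X.1.1 + (hatInc ℱ P s X.2.1 Y.2.1 - hatInc ℱ P s X.1.1 Y.1.1) +
      (tildeInc ℱ P s X.2.1 Y.2.1 - tildeInc ℱ P s X.1.1 Y.1.1) = Y.2.1 - Y.1.1 by
    simp only [tildeInc]; abel, eLpNorm_sub_comm Y.2.1, eLpNorm_sub_comm X.2.1] at hsm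
  have htop1 : (1 + (eLpNorm X.1.1 p P + eLpNorm X.2.1 p P)) ≠ ∞ :=
    ENNReal.add_ne_top.2 ⟨by simp, ENNReal.add_ne_top.2
      ⟨X.1.2.2.eLpNorm_ne_top, X.2.2.2.eLpNorm_ne_top⟩⟩
  have htop2 : (1 + (eLpNorm X.1.1 p P + eLpNorm X.2.1 p P)) * ((t - s) ^ β : ℝ≥0) ≠ ∞ :=
    ENNReal.mul_ne_top htop1 ENNReal.coe_ne_top
  have htop : eLpNorm (X.1.1 - X.2.1) p P +
      (1 + (eLpNorm X.1.1 p P + eLpNorm X.2.1 p P)) * ((t - s) ^ β : ℝ≥0) ≠ ∞ :=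
    ENNReal.add_ne_top.2 ⟨hD.eLpNorm_ne_top, htop2⟩
  have hg := ENNReal.toReal_mono (ENNReal.mul_ne_top ENNReal.coe_ne_top htop) hg
  have hg' := ENNReal.toReal_mono (ENNReal.mul_ne_top ENNReal.coe_ne_top htop) hg'
  rw [ENNReal.toReal_mul, ENNReal.toReal_add hD.eLpNorm_ne_top htop2, ENNReal.toReal_mul,
    ENNReal.toReal_add (by simp) (ENNReal.add_ne_top.2
      ⟨X.1.2.2.eLpNorm_ne_top, X.2.2.2.eLpNorm_ne_top⟩),
    ENNReal.toReal_add X.1.2.2.eLpNorm_ne_top X.2.2.2.eLpNorm_ne_top,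
    ENNReal.coe_toReal, ENNReal.coe_toReal, ENNReal.toReal_one,
    eLpNorm_eq_of_map_eq X.1.measurable hX1, eLpNorm_eq_of_map_eq X.2.measurable hX2] at hg hg'
  push_cast [NNReal.coe_sub hst] at hg hg'
  have hh0 : 0 ≤ h := h0.trans hh
  have hE : (1 + (μ.norm.toReal + ν.norm.toReal)) * ((t : ℝ) - s) ^ β ≤ S * h ^ β := by
    have := μ.nrm_nonneg
    have := ν.nrm_nonneg
    have hb := Real.rpow_le_rpow h0 hh hβ
    exact mul_le_mul hS hb (by positivity) (by linarith)
  have hE0 : 0 ≤ (1 + (μ.norm.toReal + ν.norm.toReal)) * ((t : ℝ) - s) ^ β := by positivity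
  have hC0 : (0 : ℝ) ≤ C := C.2
  have hM := stepConst_nonneg hC0 T.2 hK0
  refine (sq_le_of_sewing ENNReal.toReal_nonneg ENNReal.toReal_nonneg ENNReal.toReal_nonneg hC0
    hK0 h0 (T := T) (E := S * h ^ β) ?_ hsm (hg.trans ?_) (hg'.trans ?_)).trans ?_
  · have : (t : ℝ) ≤ T := hT
    have hs0 : (0 : ℝ) ≤ s := s.2
    linarith
  · gcongr
  · gcongr
  · change _ * (1 + stepConst C T K * _) + stepConst C T K * _ * _ ≤ _
    gcongr

end OneStep

/-! ### Schemes indexed by finite sets of times -/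

section Run

variable {E : Type*}

/-- The composition of `Θ` along a decreasing list of times, the last time being applied last. -/
def runList (Θ : ℝ≥0 → ℝ≥0 → E → E) : List ℝ≥0 → E → E
  | [], μ => μ
  | [_], μ => μ
  | t :: u :: l, μ => Θ u t (runList Θ (u :: l) μ)

/-- The composition of `Θ` along the increasing enumeration of a finite set of times. -/
noncomputable def run (Θ : ℝ≥0 → ℝ≥0 → E → E) (S : Finset ℝ≥0) : E → E :=
  runList Θ (S.sort (· ≥ ·))

/-- `S` is a finite subset of `[s, t]` that contains both endpoints. -/
structure IsPart (s t : ℝ≥0) (S : Finset ℝ≥0) : Prop where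
  left_mem : s ∈ S
  right_mem : t ∈ S
  left_le : ∀ x ∈ S, s ≤ x
  le_right : ∀ x ∈ S, x ≤ t

/-- The gaps of `S` in `[s, t]` are at most `h`. -/
def IsFine (h s t : ℝ≥0) (S : Finset ℝ≥0) : Prop :=
  ∀ x, s ≤ x → x < t → ∃ y ∈ S, x < y ∧ y ≤ x + h

/-- `B` is obtained from `A` by inserting at most one point into each gap. -/
structure SimpleInsertion (A B : Finset ℝ≥0) : Prop where
  subset : A ⊆ B
  exists_between : ∀ x ∈ B, x ∉ A → ∀ y ∈ B, y ∉ A → x < y → ∃ z ∈ A, x < z ∧ z < y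

variable {Θ : ℝ≥0 → ℝ≥0 → E → E} {s r t u : ℝ≥0} {S A B : Finset ℝ≥0}

lemma IsPart.le (h : IsPart s t S) : s ≤ t := h.left_le t h.right_mem

lemma isPart_singleton (s : ℝ≥0) : IsPart s s {s} := ⟨by simp, by simp, by simp, by simp⟩

lemma IsPart.insert_right (h : IsPart s u S) (hut : u ≤ t) : IsPart s t (insert t S) := by
  refine ⟨by simp [h.left_mem], by simp, ?_, ?_⟩
  · intro x hx
    rcases Finset.mem_insert.1 hx with rfl | hx
    · exact h.le.trans hut
    · exact h.left_le x hx
  · intro x hx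
    rcases Finset.mem_insert.1 hx with rfl | hx
    · exact le_rfl
    · exact (h.le_right x hx).trans hut

lemma run_singleton (s : ℝ≥0) (μ : E) : run Θ {s} μ = μ := by
  simp [run, runList]

lemma run_insert (h : IsPart s u S) (hut : u < t) (μ : E) :
    run Θ (insert t S) μ = Θ u t (run Θ S μ) := by
  have h1 : (insert t S).sort (· ≥ ·) = t :: S.sort (· ≥ ·) :=
    Finset.sort_insert _ (fun b hb => (h.le_right b hb).trans hut.le)
      (fun ht => (h.le_right t ht).not_gt hut)
  have h2 : S.sort (· ≥ ·) = u :: (S.erase u).sort (· ≥ ·) := by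
    conv_lhs => rw [← Finset.insert_erase h.right_mem]
    exact Finset.sort_insert _ (fun b hb => h.le_right b (Finset.mem_of_mem_erase hb))
      (Finset.notMem_erase _ _)
  rw [run, run, h1, h2, runList]

lemma run_insert_of_le (hΘ : ∀ t, Θ t t = id) (h : IsPart s u S) (hut : u ≤ t) (μ : E) :
    run Θ (insert t S) μ = Θ u t (run Θ S μ) := by
  rcases hut.eq_or_lt with rfl | hut
  · rw [Finset.insert_eq_of_mem h.right_mem, hΘ, id]
  · exact run_insert h hut μ

/-- Induction on the last point of a finite set of times. -/
lemma IsPart.induction {Q : Finset ℝ≥0 → ℝ≥0 → Prop} (h0 : Q {s} s)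
    (hstep : ∀ S u t, IsPart s u S → u < t → Q S u → Q (insert t S) t) (h : IsPart s t S) :
    Q S t := by
  induction S using Finset.induction_on_max generalizing t with
  | empty => exact absurd h.left_mem (by simp)
  | insert a S ha ih =>
    have hta : t = a := by
      refine le_antisymm ?_ (h.le_right a (by simp))
      rcases Finset.mem_insert.1 h.right_mem with rfl | ht
      · exact le_rfl
      · exact (ha t ht).le
    subst hta
    rcases S.eq_empty_or_nonempty with rfl | hS
    · have : s = t := by simpa using h.left_mem
      subst this
      exact h0
    · have hs : s ∈ S := by
        rcases Finset.mem_insert.1 h.left_mem with rfl | hs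
        · obtain ⟨x, hx⟩ := hS
          exact absurd (h.left_le x (by simp [hx])) (ha x hx).not_ge
        · exact hs
      have hp : IsPart s (S.max' hS) S := ⟨hs, S.max'_mem hS,
        fun x hx => h.left_le x (by simp [hx]), fun x hx => S.le_max' x hx⟩
      exact hstep S _ t hp (ha _ (S.max'_mem hS)) (ih hp)

lemma IsPart.filter_le (h : IsPart s t S) (hr : r ∈ S) : IsPart s r (S.filter (· ≤ r)) :=
  ⟨by simp [h.left_mem, h.left_le r hr], by simp [hr],
    fun x hx => h.left_le x (Finset.mem_filter.1 hx).1, fun x hx => (Finset.mem_filter.1 hx).2⟩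

lemma IsPart.filter_ge (h : IsPart s t S) (hr : r ∈ S) : IsPart r t (S.filter (r ≤ ·)) :=
  ⟨by simp [hr], by simp [h.right_mem, h.le_right r hr],
    fun x hx => (Finset.mem_filter.1 hx).2, fun x hx => h.le_right x (Finset.mem_filter.1 hx).1⟩

lemma run_eq_run_run (h : IsPart s t S) (hr : r ∈ S) (μ : E) :
    run Θ S μ = run Θ (S.filter (r ≤ ·)) (run Θ (S.filter (· ≤ r)) μ) := by
  revert hr
  refine h.induction (Q := fun S _ => r ∈ S → run Θ S μ =
    run Θ (S.filter (r ≤ ·)) (run Θ (S.filter (· ≤ r)) μ)) ?_ ?_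
  · intro hr
    rw [Finset.mem_singleton] at hr
    subst hr
    simp [Finset.filter_singleton, run_singleton]
  · intro S u t hS hut ih hr
    rcases Finset.mem_insert.1 hr with rfl | hr
    · have h1 : (insert r S).filter (r ≤ ·) = {r} := by
        ext x
        simp only [Finset.mem_filter, Finset.mem_insert, Finset.mem_singleton]
        constructor
        · rintro ⟨rfl | hx, hrx⟩
          · rfl
          · exact absurd (hS.le_right x hx) (hut.trans_le hrx).not_ge
        · rintro rfl; simp
      have h2 : (insert r S).filter (· ≤ r) = insert r S := by
        refine Finset.filter_true_of_mem fun x hx => ?_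
        exact (hS.insert_right hut.le).le_right x hx
      rw [h1, h2, run_singleton]
    · have hrt := (hS.le_right r hr).trans_lt hut
      have h1 : (insert t S).filter (r ≤ ·) = insert t (S.filter (r ≤ ·)) := by
        rw [Finset.filter_insert, if_pos hrt.le]
      have h2 : (insert t S).filter (· ≤ r) = S.filter (· ≤ r) := by
        rw [Finset.filter_insert, if_neg hrt.not_ge]
      rw [h1, h2, run_insert hS hut, run_insert (hS.filter_ge hr) hut, ih hr]

/-- Repeated times are allowed: they disappear from the image, and the corresponding steps are the
identity. From here on partitions are finite sets, for which unions and insertions are easy to form.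
-/
lemma compose_eq_run (hΘ : ∀ t, Θ t t = id) {τ : ℕ → ℝ≥0} {N : ℕ}
    (hτ : ∀ i < N, τ i ≤ τ (i + 1)) (μ : E) :
    IsPart (τ 0) (τ N) ((Finset.range (N + 1)).image τ) ∧
      compose Θ τ N μ = run Θ ((Finset.range (N + 1)).image τ) μ := by
  induction N with
  | zero => simp [compose, run_singleton, isPart_singleton]
  | succ N ih =>
    obtain ⟨h1, h2⟩ := ih fun i hi => hτ i (hi.trans (Nat.lt_succ_self N))
    have hN := hτ N (Nat.lt_succ_self N)
    rw [Finset.range_add_one, Finset.image_insert]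
    exact ⟨h1.insert_right hN, by rw [run_insert_of_le hΘ h1 hN, compose, h2]⟩

lemma IsFine.mono {h : ℝ≥0} (hA : IsFine h s t A) (hAB : A ⊆ B) : IsFine h s t B :=
  fun x hx hxt => let ⟨y, hy, hxy⟩ := hA x hx hxt; ⟨y, hAB hy, hxy⟩

end Run

/-! ### Stability under simple insertions: discrete Gronwall -/

section Stability

variable {p : ℝ≥0} {H : Type*} [NormedAddCommGroup H] [InnerProductSpace ℝ H] [CompleteSpace H]
  [SecondCountableTopology H] [MeasurableSpace H] [BorelSpace H]
  {Ω : Type*} {mΩ : MeasurableSpace Ω} {ℱ : Filtration ℝ≥0 mΩ} {P : Measure Ω}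
  [IsProbabilityMeasure P]
  {Θ : ℝ≥0 → ℝ≥0 → PSpace p H → PSpace p H} {β : ℝ} {L C : ℝ≥0}
  {𝒳 : ∀ s _r t : ℝ≥0, LpAt H p ℱ P s × LpAt H p ℱ P s → LpAt H p ℱ P t × LpAt H p ℱ P t}

lemma IsCouplingFamily.one_add_nrm_run_sq_le (h𝒳 : IsCouplingFamily ℱ P Θ β L C 𝒳)
    (hp : 1 ≤ p) (hA : Atomless ℱ P) {K : ℝ} (hK0 : 0 ≤ K) (hK : IsSmoothConst p K H Ω)
    {s t T : ℝ≥0} {S : Finset ℝ≥0} (hS : IsPart s t S) (hT : t ≤ T) (μ : PSpace p H) :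
    1 + (run Θ S μ).nrm ^ 2 ≤ (1 + μ.nrm ^ 2) * Real.exp (stepConst L T K * ((t : ℝ) - s)) := by
  revert hT
  refine hS.induction (Q := fun S t => t ≤ T → 1 + (run Θ S μ).nrm ^ 2 ≤
    (1 + μ.nrm ^ 2) * Real.exp (stepConst L T K * ((t : ℝ) - s))) ?_ ?_
  · intro _
    simp [run_singleton]
  · intro S u t hS hut ih hT
    rw [run_insert hS hut]
    refine (h𝒳.one_add_nrm_sq_le hp hA hK0 hK hut.le hT _).trans ?_
    have h1 : 1 + stepConst L T K * ((t : ℝ) - u) ≤ Real.exp (stepConst L T K * ((t : ℝ) - u)) := by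
      rw [add_comm]; exact Real.add_one_le_exp _
    refine (mul_le_mul_of_nonneg_left h1 (by positivity)).trans ?_
    refine (mul_le_mul_of_nonneg_right (ih (hut.le.trans hT)) (by positivity)).trans ?_
    rw [mul_assoc, ← Real.exp_add]
    apply le_of_eq
    ring_nf

lemma IsCouplingFamily.nrm_run_le (h𝒳 : IsCouplingFamily ℱ P Θ β L C 𝒳)
    (hp : 1 ≤ p) (hA : Atomless ℱ P) {K : ℝ} (hK0 : 0 ≤ K) (hK : IsSmoothConst p K H Ω)
    {s t T : ℝ≥0} {S : Finset ℝ≥0} (hS : IsPart s t S) (hT : t ≤ T) (μ : PSpace p H) :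
    (run Θ S μ).nrm ≤ Real.exp (stepConst L T K * T) * (1 + μ.nrm) := by
  have h := h𝒳.one_add_nrm_run_sq_le hp hA hK0 hK hS hT μ
  have hM : 0 ≤ stepConst L T K := stepConst_nonneg L.2 T.2 hK0
  have hT' : (t : ℝ) ≤ T := hT
  have hs0 : (0 : ℝ) ≤ s := s.2
  have h1 : Real.exp (stepConst L T K * ((t : ℝ) - s)) ≤ Real.exp (stepConst L T K * T) := by
    gcongr; linarith
  have h2 : 1 ≤ Real.exp (stepConst L T K * T) := Real.one_le_exp (mul_nonneg hM T.2)
  have hμ := μ.nrm_nonneg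
  refine (sq_le_sq₀ (PSpace.nrm_nonneg _) (by positivity)).1 ?_
  have h3 : (1 + μ.nrm ^ 2) * Real.exp (stepConst L T K * ((t : ℝ) - s)) ≤
      (1 + μ.nrm) ^ 2 * Real.exp (stepConst L T K * T) ^ 2 := by
    gcongr
    · nlinarith
    · exact h1.trans (le_self_pow₀ h2 (by norm_num))
  rw [mul_pow]
  linarith

/-- Induction on the last point of `A`, with `B` arbitrary and cut at the last but one point of `A`.
Iterating the one-step bound yields the exponential factor, while the errors, proportional to the
step lengths, add up to `t - s`. -/
lemma IsCouplingFamily.coupled_run (h𝒳 : IsCouplingFamily ℱ P Θ β L C 𝒳)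
    (hΘ : ∀ t, Θ t t = id) (hp : 1 ≤ p) (hA : Atomless ℱ P) (hβ : 0 ≤ β)
    {K : ℝ} (hK0 : 0 ≤ K) (hK : IsSmoothConst p K H Ω)
    {s t T h : ℝ≥0} {A B : Finset ℝ≥0} (hAp : IsPart s t A) (hBp : IsPart s t B)
    (hAB : SimpleInsertion A B) (hfine : IsFine h s t A) (hT : t ≤ T) {μ ν : PSpace p H} {q : ℝ}
    (hc : Coupled ℱ P s μ ν q) :
    Coupled ℱ P t (run Θ A μ) (run Θ B ν)
      (Real.exp (stepConst C T K * ((t : ℝ) - s)) * (q + stepConst C T K * ((t : ℝ) - s) *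
        (3 * Real.exp (stepConst L T K * T) * (1 + (μ.nrm + ν.nrm)) * (h : ℝ) ^ β) ^ 2)) := by
  set G := Real.exp (stepConst L T K * T) with hG
  set E := (3 * G * (1 + (μ.nrm + ν.nrm)) * (h : ℝ) ^ β) ^ 2 with hE
  set M := stepConst C T K with hM
  have hM0 : 0 ≤ M := stepConst_nonneg C.2 T.2 hK0
  have hE0 : 0 ≤ E := sq_nonneg _
  revert hT hfine hAB hBp B
  refine hAp.induction (Q := fun A t => ∀ {B : Finset ℝ≥0}, IsPart s t B → SimpleInsertion A B →
    IsFine h s t A → t ≤ T → Coupled ℱ P t (run Θ A μ) (run Θ B ν)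
      (Real.exp (M * ((t : ℝ) - s)) * (q + M * ((t : ℝ) - s) * E))) ?_ ?_
  · intro B hBp _ _ _
    have : B = {s} := by
      ext x
      rw [Finset.mem_singleton]
      exact ⟨fun hx => le_antisymm (hBp.le_right x hx) (hBp.left_le x hx),
        fun hx => hx ▸ hBp.left_mem⟩
    subst this
    simpa [run_singleton] using hc
  · intro A u t hA' hut ih B hBp hAB hfine hT
    have huT := hut.le.trans hT
    have huB : u ∈ B := hAB.subset (by simp [hA'.right_mem])
    have hB1 := hBp.filter_le huB
    set B₁ := B.filter (· ≤ u) with hB₁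
    have hins : SimpleInsertion A B₁ := by
      refine ⟨fun x hx => Finset.mem_filter.2 ⟨hAB.subset (by simp [hx]), hA'.le_right x hx⟩, ?_⟩
      intro x hx hxA y hy hyA hxy
      rw [hB₁, Finset.mem_filter] at hx hy
      obtain ⟨z, hz, hxz, hzy⟩ := hAB.exists_between x hx.1
        (by simp [hxA, (hx.2.trans_lt hut).ne]) y hy.1 (by simp [hyA, (hy.2.trans_lt hut).ne]) hxy
      refine ⟨z, ?_, hxz, hzy⟩
      rcases Finset.mem_insert.1 hz with rfl | hz
      · exact absurd (hzy.trans_le hy.2) hut.not_gt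
      · exact hz
    have hfine' : IsFine h s u A := by
      intro x hsx hxu
      obtain ⟨y, hy, hxy, hyh⟩ := hfine x hsx (hxu.trans hut)
      rcases Finset.mem_insert.1 hy with rfl | hy
      · exact ⟨u, hA'.right_mem, hxu, hut.le.trans hyh⟩
      · exact ⟨y, hy, hxy, hyh⟩
    have htu : (t : ℝ) - u ≤ h := by
      obtain ⟨y, hy, hxy, hyh⟩ := hfine u hA'.le hut
      rcases Finset.mem_insert.1 hy with rfl | hy
      · have : (y : ℝ) ≤ u + h := by exact_mod_cast hyh
        linarith
      · exact absurd (hA'.le_right y hy) hxy.not_ge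
    have hcu := ih hB1 hins hfine' huT
    -- Here `r` is the only point of `B` inside the last gap of `A`. If there is none, `r = t`
    -- serves, since `Θ t t = id`.
    have hrB : ∃ r, u ≤ r ∧ r ≤ t ∧ run Θ B ν = Θ r t (Θ u r (run Θ B₁ ν)) := by
      by_cases hr : ∃ r ∈ B, u < r ∧ r < t
      · obtain ⟨r, hrB, hur, hrt⟩ := hr
        refine ⟨r, hur.le, hrt.le, ?_⟩
        have hB : B = insert t (insert r B₁) := by
          ext x
          simp only [Finset.mem_insert, hB₁, Finset.mem_filter]
          constructor
          · intro hx
            by_contra! hne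
            have hux := hne.2.2 hx
            have hxt := lt_of_le_of_ne (hBp.le_right x hx) hne.1
            have hnot : ∀ w, u < w → w < t → w ∉ insert t A := by
              intro w huw hwt hw
              rcases Finset.mem_insert.1 hw with rfl | hw
              · exact lt_irrefl _ hwt
              · exact (hA'.le_right w hw).not_gt huw
            rcases lt_or_gt_of_ne hne.2.1 with hlt | hlt
            · obtain ⟨z, hz, hxz, hzr⟩ := hAB.exists_between x hx (hnot x hux hxt) r hrB
                (hnot r hur hrt) hlt
              exact hnot z (hux.trans hxz) (hzr.trans hrt) hz
            · obtain ⟨z, hz, hxz, hzr⟩ := hAB.exists_between r hrB (hnot r hur hrt) x hx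
                (hnot x hux hxt) hlt
              exact hnot z (hur.trans hxz) (hzr.trans hxt) hz
          · rintro (rfl | rfl | hx)
            · exact hBp.right_mem
            · exact hrB
            · exact hx.1
        conv_lhs => rw [hB]
        rw [run_insert (hB1.insert_right hur.le) hrt, run_insert hB1 hur]
      · refine ⟨t, hut.le, le_rfl, ?_⟩
        have hB : B = insert t B₁ := by
          ext x
          simp only [Finset.mem_insert, hB₁, Finset.mem_filter]
          constructor
          · intro hx
            by_contra! hne
            exact hr ⟨x, hx, hne.2 hx, lt_of_le_of_ne (hBp.le_right x hx) hne.1⟩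
          · rintro (rfl | hx)
            · exact hBp.right_mem
            · exact hx.1
        conv_lhs => rw [hB]
        rw [run_insert hB1 hut, hΘ t, id]
    obtain ⟨r, hur, hrt, hrun⟩ := hrB
    rw [run_insert hA' hut, hrun]
    -- The factor `3` covers the `1` and the two growth bounds, as `G ≥ 1`.
    have hS : 1 + ((run Θ A μ).nrm + (run Θ B₁ ν).nrm) ≤ 3 * G * (1 + (μ.nrm + ν.nrm)) := by
      have h1 := h𝒳.nrm_run_le hp hA hK0 hK hA' huT μ
      have h2 := h𝒳.nrm_run_le hp hA hK0 hK hB1 huT ν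
      have h3 : 1 ≤ G := Real.one_le_exp
        (mul_nonneg (stepConst_nonneg L.2 T.2 hK0) T.2)
      have h4 := μ.nrm_nonneg
      have h5 := ν.nrm_nonneg
      rw [← hG] at h1 h2
      nlinarith
    obtain ⟨X, hX1, hX2, hX⟩ := h𝒳.coupled_step hp hβ hK0 hK hur hrt hT hS htu hcu
    refine ⟨X, hX1, hX2, hX.trans ?_⟩
    rw [← hM, ← hE]
    have hx0 : 0 ≤ (t : ℝ) - u := by
      have : (u : ℝ) ≤ t := hut.le
      linarith
    have hy0 : 0 ≤ (u : ℝ) - s := by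
      have : (s : ℝ) ≤ u := hA'.le
      linarith
    have hq0 : 0 ≤ q := by
      obtain ⟨_, _, _, h⟩ := hc
      exact (sq_nonneg _).trans h
    have e1 : Real.exp (M * ((t : ℝ) - s)) =
        Real.exp (M * ((u : ℝ) - s)) * Real.exp (M * ((t : ℝ) - u)) := by
      rw [← Real.exp_add]; ring_nf
    have e2 : 1 + M * ((t : ℝ) - u) ≤ Real.exp (M * ((t : ℝ) - u)) := by
      rw [add_comm]; exact Real.add_one_le_exp _
    have e3 : 1 ≤ Real.exp (M * ((t : ℝ) - s)) :=
      Real.one_le_exp (mul_nonneg hM0 (by linarith))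
    calc Real.exp (M * ((u : ℝ) - s)) * (q + M * ((u : ℝ) - s) * E) * (1 + M * ((t : ℝ) - u)) +
          M * ((t : ℝ) - u) * E
        ≤ Real.exp (M * ((u : ℝ) - s)) * (q + M * ((u : ℝ) - s) * E) *
            Real.exp (M * ((t : ℝ) - u)) +
          Real.exp (M * ((t : ℝ) - s)) * (M * ((t : ℝ) - u) * E) := by
          exact add_le_add (by gcongr) (le_mul_of_one_le_left (by positivity) e3)
      _ = _ := by
          rw [e1]; ring

/-- Stability of the schemes of `Θ` on subintervals of `[0, T]` under insertion of points, with
constant `M`. -/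
structure SchemeEstimate (Θ : ℝ≥0 → ℝ≥0 → PSpace p H → PSpace p H) (β : ℝ) (T M : ℝ≥0) :
    Prop where
  stable : ∀ {s t h : ℝ≥0} {A B : Finset ℝ≥0}, IsPart s t A → IsPart s t B →
    SimpleInsertion A B → IsFine h s t A → t ≤ T → ∀ μ ν : PSpace p H,
      W (run Θ A μ) (run Θ B ν) ≤
        M * (W μ ν + (1 + (μ.norm + ν.norm)) * ((t - s) ^ (1 / 2 : ℝ) * h ^ β : ℝ≥0))
  norm_le : ∀ {s t : ℝ≥0} {S : Finset ℝ≥0}, IsPart s t S → t ≤ T → ∀ μ : PSpace p H,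
    1 + (run Θ S μ).norm ≤ M * (1 + μ.norm)

/-- The square root of the Gronwall bound: the factor `t - s` in front of the squared error becomes
`(t - s) ^ (1 / 2)`. Every coupling of `μ` and `ν` can be realized at time `s`, so the infimum may
be taken at the end. -/
lemma IsCouplingFamily.W_run_le (h𝒳 : IsCouplingFamily ℱ P Θ β L C 𝒳)
    (hΘ : ∀ t, Θ t t = id) (hp : 1 ≤ p) (hA : Atomless ℱ P) (hβ : 0 ≤ β)
    {K : ℝ} (hK0 : 0 ≤ K) (hK : IsSmoothConst p K H Ω)
    {s t T h : ℝ≥0} {A B : Finset ℝ≥0} (hAp : IsPart s t A) (hBp : IsPart s t B)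
    (hAB : SimpleInsertion A B) (hfine : IsFine h s t A) (hT : t ≤ T) (μ ν : PSpace p H)
    {N : ℝ≥0} (hN : Real.exp (stepConst C T K * T) * (1 + Real.sqrt (stepConst C T K) *
      (3 * Real.exp (stepConst L T K * T))) ≤ N) :
    W (run Θ A μ) (run Θ B ν) ≤
      N * (W μ ν + (1 + (μ.norm + ν.norm)) * ((t - s) ^ (1 / 2 : ℝ) * h ^ β : ℝ≥0)) := by
  set M := stepConst C T K with hM
  set G := Real.exp (stepConst L T K * T) with hG
  have hM0 : 0 ≤ M := stepConst_nonneg C.2 T.2 hK0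
  have hN1 : (1 : ℝ) ≤ N := by
    refine le_trans ?_ hN
    exact one_le_mul_of_one_le_of_one_le (Real.one_le_exp (mul_nonneg hM0 T.2))
      (le_add_of_nonneg_right (by positivity))
  have hN0 : (N : ℝ≥0∞) ≠ 0 := by
    have : N ≠ 0 := by rintro rfl; norm_num at hN1
    exact_mod_cast this
  -- Isolates `W μ ν` on the right, so that it is enough to treat each coupling separately.
  suffices W (run Θ A μ) (run Θ B ν) / N -
      (1 + (μ.norm + ν.norm)) * ((t - s) ^ (1 / 2 : ℝ) * h ^ β : ℝ≥0) ≤ W μ ν by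
    rw [mul_comm, ← ENNReal.div_le_iff_le_mul (Or.inl hN0) (Or.inl ENNReal.coe_ne_top)]
    exact tsub_le_iff_right.1 this
  refine le_iInf₂ fun Γ hΓ => ?_
  rw [tsub_le_iff_right, ENNReal.div_le_iff_le_mul (Or.inl hN0) (Or.inl ENNReal.coe_ne_top),
    mul_comm]
  obtain ⟨X, hX1, hX2, hX⟩ := exists_pair_of_isCoupling (p := p) hA s hΓ
  have hc : Coupled ℱ P s μ ν ((eLpNorm (fun z : H × H => z.1 - z.2) p Γ).toReal ^ 2) :=
    ⟨X, hX1, hX2, by rw [hX]⟩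
  have htop : eLpNorm (fun z : H × H => z.1 - z.2) p Γ ≠ ∞ := by
    rw [← hX]; exact (X.1.2.2.sub X.2.2.2).eLpNorm_ne_top
  refine (h𝒳.coupled_run hΘ hp hA hβ hK0 hK hAp hBp hAB hfine hT hc).W_le.trans ?_
  set d := (eLpNorm (fun z : H × H => z.1 - z.2) p Γ).toReal with hd
  have hd0 : 0 ≤ d := ENNReal.toReal_nonneg
  rw [← ENNReal.ofReal_toReal htop, ← hd, ← PSpace.ofReal_nrm, ← PSpace.ofReal_nrm,
    ← ENNReal.ofReal_add μ.nrm_nonneg ν.nrm_nonneg, ← ENNReal.ofReal_one,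
    ← ENNReal.ofReal_add zero_le_one (add_nonneg μ.nrm_nonneg ν.nrm_nonneg),
    ← ENNReal.ofReal_coe_nnreal, ← ENNReal.ofReal_coe_nnreal,
    ← ENNReal.ofReal_mul (add_nonneg zero_le_one (add_nonneg μ.nrm_nonneg ν.nrm_nonneg)),
    ← ENNReal.ofReal_add hd0 (mul_nonneg (add_nonneg zero_le_one
      (add_nonneg μ.nrm_nonneg ν.nrm_nonneg)) (NNReal.coe_nonneg _)),
    ← ENNReal.ofReal_mul (NNReal.coe_nonneg _)]
  refine ENNReal.ofReal_le_ofReal ?_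
  push_cast [NNReal.coe_sub hAp.le]
  have hx0 : 0 ≤ (t : ℝ) - s := by
    have : (s : ℝ) ≤ t := hAp.le
    linarith
  have hxT : (t : ℝ) - s ≤ T := by
    have : (t : ℝ) ≤ T := hT
    have : (0 : ℝ) ≤ s := s.2
    linarith
  have hμ := μ.nrm_nonneg
  have hν := ν.nrm_nonneg
  set R := (1 + (μ.nrm + ν.nrm)) * (((t : ℝ) - s) ^ (1 / 2 : ℝ) * (h : ℝ) ^ β) with hR
  have hR0 : 0 ≤ R := by positivity
  have hsq : (((t : ℝ) - s) ^ (1 / 2 : ℝ)) ^ 2 = (t : ℝ) - s := by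
    rw [← Real.sqrt_eq_rpow, Real.sq_sqrt hx0]
  have e1 : M * ((t : ℝ) - s) * (3 * G * (1 + (μ.nrm + ν.nrm)) * (h : ℝ) ^ β) ^ 2 =
      (Real.sqrt M * (3 * G) * R) ^ 2 := by
    have h0 := Real.sq_sqrt hM0
    generalize Real.sqrt M = m at h0 ⊢
    generalize ((t : ℝ) - s) ^ (1 / 2 : ℝ) = x at hsq hR
    rw [← h0, ← hsq, hR]
    ring
  have h1 : Real.exp (M * ((t : ℝ) - s)) ≤ Real.exp (M * T) := by gcongr
  have h2 : Real.exp (M * ((t : ℝ) - s)) ≤ Real.exp (M * T) ^ 2 :=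
    h1.trans (le_self_pow₀ (Real.one_le_exp (mul_nonneg hM0 T.2)) (by norm_num))
  rw [e1]
  refine Real.sqrt_le_iff.2 ⟨by positivity, ?_⟩
  have hG0 : 0 ≤ G := (Real.exp_pos _).le
  calc Real.exp (M * ((t : ℝ) - s)) * (d ^ 2 + (Real.sqrt M * (3 * G) * R) ^ 2)
      ≤ Real.exp (M * T) ^ 2 * (d + Real.sqrt M * (3 * G) * R) ^ 2 := by
        gcongr
        have : 0 ≤ d * (Real.sqrt M * (3 * G) * R) := by positivity
        nlinarith
    _ = (Real.exp (M * T) * (d + Real.sqrt M * (3 * G) * R)) ^ 2 := by ring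
    _ ≤ (Real.exp (M * T) * ((1 + Real.sqrt M * (3 * G)) * (d + R))) ^ 2 := by
        gcongr
        have : 0 ≤ Real.sqrt M * (3 * G) * d := by positivity
        nlinarith
    _ ≤ (N * (d + R)) ^ 2 := by
        rw [← mul_assoc]
        gcongr

/-- `M` is fixed before the spaces and `Θ`, because the smoothness constant is. The maximum serves
the stability and the moment bound together. -/
lemma exists_schemeEstimate {p : ℝ≥0} (hp : 2 ≤ p) {β : ℝ} (hβ : 0 < β) (T L C : ℝ≥0) :
    ∃ M : ℝ≥0, ∀ (H : Type u) [NormedAddCommGroup H] [InnerProductSpace ℝ H] [CompleteSpace H]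
      [SecondCountableTopology H] [MeasurableSpace H] [BorelSpace H]
      (Ω : Type v) [mΩ : MeasurableSpace Ω] (P : Measure Ω) [IsProbabilityMeasure P]
      (ℱ : Filtration ℝ≥0 mΩ) (Θ : ℝ≥0 → ℝ≥0 → PSpace p H → PSpace p H),
      Atomless ℱ P → (∀ t : ℝ≥0, Θ t t = id) → SewingProperty ℱ P Θ β L C →
      SchemeEstimate Θ β T M := by
  have hp1 : 1 ≤ p := one_le_two.trans hp
  obtain ⟨K, hK0, hK⟩ := exists_isSmoothConst.{u, v} hp
  refine ⟨max (Real.toNNReal (Real.exp (stepConst C T K * T) * (1 + Real.sqrt (stepConst C T K) *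
    (3 * Real.exp (stepConst L T K * T))))) (Real.toNNReal (1 + Real.exp (stepConst L T K * T))),
    fun H _ _ _ _ _ _ Ω _ P _ ℱ Θ hA hΘ ⟨𝒳, h𝒳⟩ => ⟨?_, ?_⟩⟩
  · intro s t h A B hAp hBp hAB hfine hT μ ν
    refine h𝒳.W_run_le hΘ hp1 hA hβ.le hK0 (hK H Ω) hAp hBp hAB hfine hT μ ν ?_
    rw [NNReal.coe_max]
    exact (Real.le_coe_toNNReal _).trans (le_max_left _ _)
  · intro s t S hS hT μ
    have h := h𝒳.nrm_run_le hp1 hA hK0 (hK H Ω) hS hT μ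
    rw [← PSpace.ofReal_nrm, ← PSpace.ofReal_nrm, ← ENNReal.ofReal_one,
      ← ENNReal.ofReal_add zero_le_one (PSpace.nrm_nonneg _),
      ← ENNReal.ofReal_add zero_le_one (PSpace.nrm_nonneg _), ← ENNReal.ofReal_coe_nnreal,
      ← ENNReal.ofReal_mul (NNReal.coe_nonneg _)]
    refine ENNReal.ofReal_le_ofReal ?_
    have hμ := μ.nrm_nonneg
    calc 1 + (run Θ S μ).nrm ≤ (1 + Real.exp (stepConst L T K * T)) * (1 + μ.nrm) := by nlinarith
      _ ≤ _ := by
        gcongr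
        rw [NNReal.coe_max]
        exact (Real.le_coe_toNNReal _).trans (le_max_right _ _)

end Stability

/-! ### Grids and simple insertions between them -/

section Grid

variable {s r t u δ h : ℝ≥0} {A B D : Finset ℝ≥0}

/-- Lets a grid be refined while the points of a given partition are kept. -/
lemma SimpleInsertion.union (hAB : SimpleInsertion A B) : SimpleInsertion (D ∪ A) (D ∪ B) := by
  refine ⟨Finset.union_subset_union_right hAB.subset, ?_⟩
  intro x hx hxA y hy hyA hxy
  simp only [Finset.mem_union, not_or] at hx hxA hy hyA
  obtain ⟨z, hz, hxz⟩ := hAB.exists_between x (hx.resolve_left hxA.1) hxA.2 y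
    (hy.resolve_left hyA.1) hyA.2 hxy
  exact ⟨z, Finset.mem_union_right _ hz, hxz⟩

lemma IsPart.union (hA : IsPart s t A) (hB : IsPart s t B) : IsPart s t (A ∪ B) := by
  refine ⟨Finset.mem_union_left _ hA.left_mem, Finset.mem_union_left _ hA.right_mem, ?_, ?_⟩
  · intro x hx
    exact (Finset.mem_union.1 hx).elim (hA.left_le x) (hB.left_le x)
  · intro x hx
    exact (Finset.mem_union.1 hx).elim (hA.le_right x) (hB.le_right x)

lemma IsFine.insert_right (hA : IsFine h s u A) (ht : t ≤ u + h) :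
    IsFine h s t (insert t A) := by
  intro x hsx hxt
  rcases lt_or_ge x u with hxu | hux
  · obtain ⟨y, hy, hxy⟩ := hA x hsx hxu
    exact ⟨y, Finset.mem_insert_of_mem hy, hxy⟩
  · exact ⟨t, Finset.mem_insert_self _ _, hxt, ht.trans (by gcongr)⟩

/-- Points that are separated by more than the fineness of `A` lie in different gaps of `A`. -/
lemma IsFine.simpleInsertion_union (hA : IsFine h s t A) (hB : IsPart s t B)
    (hsep : ∀ x ∈ B, x ∉ A → ∀ y ∈ B, y ∉ A → x < y → x + h < y) :
    SimpleInsertion A (A ∪ B) := by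
  refine ⟨Finset.subset_union_left, ?_⟩
  intro x hx hxA y hy hyA hxy
  have hx := (Finset.mem_union.1 hx).resolve_left hxA
  have hy := (Finset.mem_union.1 hy).resolve_left hyA
  obtain ⟨z, hz, hxz, hzh⟩ := hA x (hB.left_le x hx) (hxy.trans_le (hB.le_right y hy))
  exact ⟨z, hz, hxz, hzh.trans_lt (hsep x hx hxA y hy hyA hxy)⟩

/-- The points of `δ ℕ` in `[s, t]`, with the endpoints `s` and `t`. -/
noncomputable def grid (δ s t : ℝ≥0) : Finset ℝ≥0 :=
  insert s (insert t (((Finset.range (⌊t / δ⌋₊ + 1)).image fun k : ℕ => k * δ).filter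
    fun x => s ≤ x ∧ x ≤ t))

lemma mem_grid (hδ : 0 < δ) {x : ℝ≥0} :
    x ∈ grid δ s t ↔ x = s ∨ x = t ∨ ∃ k : ℕ, k * δ = x ∧ s ≤ x ∧ x ≤ t := by
  simp only [grid, Finset.mem_insert, Finset.mem_filter, Finset.mem_image, Finset.mem_range]
  refine or_congr Iff.rfl (or_congr Iff.rfl ⟨?_, ?_⟩)
  · rintro ⟨⟨k, -, hk⟩, h⟩
    exact ⟨k, hk, h⟩
  · rintro ⟨k, hk, h⟩
    refine ⟨⟨k, Nat.lt_succ_of_le (Nat.le_floor ?_), hk⟩, h⟩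
    rw [le_div_iff₀ hδ, hk]
    exact h.2

lemma isPart_grid (hδ : 0 < δ) (hst : s ≤ t) : IsPart s t (grid δ s t) := by
  refine ⟨(mem_grid hδ).2 (Or.inl rfl), (mem_grid hδ).2 (Or.inr (Or.inl rfl)), ?_, ?_⟩
  · intro x hx
    rcases (mem_grid hδ).1 hx with rfl | rfl | ⟨k, -, h⟩
    exacts [le_rfl, hst, h.1]
  · intro x hx
    rcases (mem_grid hδ).1 hx with rfl | rfl | ⟨k, -, h⟩
    exacts [hst, le_rfl, h.2]

lemma isFine_grid (hδ : 0 < δ) : IsFine δ s t (grid δ s t) := by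
  intro x hsx hxt
  have h1 : x < (⌊x / δ⌋₊ + 1 : ℕ) * δ := by
    rw [← div_lt_iff₀ hδ]
    exact_mod_cast Nat.lt_floor_add_one (x / δ)
  have h2 : (⌊x / δ⌋₊ + 1 : ℕ) * δ ≤ x + δ := by
    push_cast
    rw [add_mul, one_mul]
    gcongr
    rw [← le_div_iff₀ hδ]
    exact Nat.floor_le zero_le
  rcases le_total ((⌊x / δ⌋₊ + 1 : ℕ) * δ) t with h | h
  · exact ⟨_, (mem_grid hδ).2 (Or.inr (Or.inr ⟨_, rfl, hsx.trans h1.le, h⟩)), h1, h2⟩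
  · exact ⟨t, (mem_grid hδ).2 (Or.inr (Or.inl rfl)), hxt, h.trans h2⟩

lemma exists_eq_mul_of_mem_grid (hδ : 0 < δ) (hA : IsPart s t A) {x : ℝ≥0}
    (hx : x ∈ grid δ s t) (hxA : x ∉ A) : ∃ k : ℕ, k * δ = x := by
  rcases (mem_grid hδ).1 hx with rfl | rfl | ⟨k, hk, -⟩
  exacts [absurd hA.left_mem hxA, absurd hA.right_mem hxA, ⟨k, hk⟩]

/-- The new points are odd multiples of `δ`, and an even multiple separates any two of them. -/
lemma simpleInsertion_grid_two (hδ : 0 < δ) (hst : s ≤ t) :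
    SimpleInsertion (grid (2 * δ) s t) (grid δ s t) := by
  have h2δ : 0 < 2 * δ := by positivity
  refine ⟨?_, ?_⟩
  · intro x hx
    rw [mem_grid h2δ] at hx
    rw [mem_grid hδ]
    refine hx.imp_right (Or.imp_right ?_)
    rintro ⟨k, rfl, h⟩
    exact ⟨2 * k, by push_cast; ring, h⟩
  · intro x hx hxA y hy hyA hxy
    have hp := isPart_grid h2δ hst
    have hsx := (isPart_grid hδ hst).left_le x hx
    have hyt := (isPart_grid hδ hst).le_right y hy
    have hodd : ∀ k : ℕ, s ≤ (k : ℝ≥0) * δ → (k : ℝ≥0) * δ ≤ t →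
        (k : ℝ≥0) * δ ∉ grid (2 * δ) s t → ¬ Even k := by
      rintro k h1 h2 hk ⟨j, rfl⟩
      exact hk ((mem_grid h2δ).2 (Or.inr (Or.inr ⟨j, by push_cast; ring, h1, h2⟩)))
    obtain ⟨k, rfl⟩ := exists_eq_mul_of_mem_grid hδ hp hx hxA
    obtain ⟨l, rfl⟩ := exists_eq_mul_of_mem_grid hδ hp hy hyA
    have hkl : k < l := by
      have := lt_of_mul_lt_mul_right hxy zero_le
      exact_mod_cast this
    have hk := hodd k hsx (hxy.le.trans hyt) hxA
    have hl := hodd l (hsx.trans hxy.le) hyt hyA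
    rw [Nat.not_even_iff_odd] at hk hl
    obtain ⟨i, rfl⟩ := hk
    obtain ⟨j, rfl⟩ := hl
    have hij : 2 * (i + 1) < 2 * j + 1 := by omega
    have e : ((i + 1 : ℕ) : ℝ≥0) * (2 * δ) = (2 * (i + 1) : ℕ) * δ := by push_cast; ring
    have h1 : ((2 * i + 1 : ℕ) : ℝ≥0) * δ < ((i + 1 : ℕ) : ℝ≥0) * (2 * δ) := by
      rw [e]
      exact mul_lt_mul_of_pos_right (by exact_mod_cast (by omega)) hδ
    have h2 : ((i + 1 : ℕ) : ℝ≥0) * (2 * δ) < ((2 * j + 1 : ℕ) : ℝ≥0) * δ := by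
      rw [e]
      exact mul_lt_mul_of_pos_right (by exact_mod_cast hij) hδ
    exact ⟨_, (mem_grid h2δ).2 (Or.inr (Or.inr ⟨i + 1, rfl, hsx.trans h1.le, h2.le.trans hyt⟩)),
      h1, h2⟩

/-- Distinct multiples of `δ` are further apart than any gap of `A` is long. -/
lemma IsFine.simpleInsertion_grid (hA : IsFine h s t A) (hAp : IsPart s t A) (hδ : h < δ) :
    SimpleInsertion A (A ∪ grid δ s t) := by
  have hδ0 : 0 < δ := pos_of_gt hδ
  refine hA.simpleInsertion_union (isPart_grid hδ0 hAp.le) ?_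
  intro x hx hxA y hy hyA hxy
  obtain ⟨k, rfl⟩ := exists_eq_mul_of_mem_grid hδ0 hAp hx hxA
  obtain ⟨l, rfl⟩ := exists_eq_mul_of_mem_grid hδ0 hAp hy hyA
  have hkl : k < l := by
    have := lt_of_mul_lt_mul_right hxy zero_le
    exact_mod_cast this
  have h1 : ((k : ℝ≥0) + 1) * δ ≤ l * δ := by
    gcongr
    exact_mod_cast hkl
  rw [add_mul, one_mul] at h1
  exact (by gcongr : (k : ℝ≥0) * δ + h < k * δ + δ).trans_le h1

lemma eventually_add_lt (S : Finset ℝ≥0) :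
    ∀ᶠ δ : ℝ≥0 in 𝓝 0, ∀ x ∈ S, ∀ y ∈ S, x < y → x + δ < y := by
  simp only [Filter.eventually_all_finset, Filter.eventually_imp_distrib_left]
  intro x _ y _ hxy
  have : Tendsto (fun δ : ℝ≥0 => x + δ) (𝓝 0) (𝓝 (x + 0)) := tendsto_id.const_add x
  rw [add_zero] at this
  exact this.eventually_lt_const hxy

lemma simpleInsertion_grid_union (hδ : 0 < δ) (hA : IsPart s t A)
    (hsep : ∀ x ∈ A, ∀ y ∈ A, x < y → x + δ < y) :
    SimpleInsertion (grid δ s t) (grid δ s t ∪ A) :=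
  (isFine_grid hδ).simpleInsertion_union hA
    fun x hx _ y hy _ hxy => hsep x hx y hy hxy

end Grid

/-! ### From an arbitrary partition to a fine grid -/

section Estimates

variable {p : ℝ≥0} {H : Type*} [NormedAddCommGroup H] [InnerProductSpace ℝ H] [CompleteSpace H]
  [SecondCountableTopology H] [MeasurableSpace H] [BorelSpace H]
  {Θ : ℝ≥0 → ℝ≥0 → PSpace p H → PSpace p H} {β : ℝ} {T M s t h δ κ : ℝ≥0} {A B : Finset ℝ≥0}

lemma SchemeEstimate.insertion (hE : SchemeEstimate Θ β T M) (hA : IsPart s t A)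
    (hB : IsPart s t B) (hAB : SimpleInsertion A B) (hfine : IsFine h s t A) (hT : t ≤ T)
    (μ : PSpace p H) :
    W (run Θ A μ) (run Θ B μ) ≤
      2 * M * (1 + μ.norm) * ((t - s) ^ (1 / 2 : ℝ) : ℝ≥0) * (h ^ β : ℝ≥0) := by
  refine (hE.stable hA hB hAB hfine hT μ μ).trans ?_
  rw [W_self, zero_add]
  have : 1 + (μ.norm + μ.norm) ≤ 2 * (1 + μ.norm) := by
    rw [mul_add, two_mul μ.norm]
    gcongr
    norm_num
  calc _ ≤ (M : ℝ≥0∞) * (2 * (1 + μ.norm) * ((t - s) ^ (1 / 2 : ℝ) * h ^ β : ℝ≥0)) := by gcongr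
    _ = _ := by push_cast; ring

/-- Each halving costs the current mesh to the power `β`, so the coarsest one dominates. The
condition on `κ` says that `κ` bounds the geometric series of ratio `2^{-β}`, in the form that
induction needs. -/
lemma SchemeEstimate.grid_chain (hp : 1 ≤ p) (hE : SchemeEstimate Θ β T M) (hA : IsPart s t A)
    (hT : t ≤ T) (hδ : 0 < δ) (hκ : κ * (2 ^ β)⁻¹ + 1 ≤ κ) (μ : PSpace p H) (I : ℕ) :
    W (run Θ (A ∪ grid (2 ^ I * δ) s t) μ) (run Θ (A ∪ grid δ s t) μ) ≤
      2 * M * (1 + μ.norm) * ((t - s) ^ (1 / 2 : ℝ) : ℝ≥0) * (κ * (2 ^ I * δ) ^ β : ℝ≥0) := by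
  induction I with
  | zero => simp [W_self]
  | succ I ih =>
    have h0 : 0 < 2 ^ I * δ := by positivity
    have e : 2 ^ (I + 1) * δ = 2 * (2 ^ I * δ) := by ring
    rw [e]
    refine (W_triangle hp _ (run Θ (A ∪ grid (2 ^ I * δ) s t) μ) _).trans ?_
    have h1 := hE.insertion (hA.union (isPart_grid (δ := 2 * (2 ^ I * δ)) (by positivity) hA.le))
      (hA.union (isPart_grid h0 hA.le)) (simpleInsertion_grid_two h0 hA.le).union
      ((isFine_grid (by positivity)).mono Finset.subset_union_right) hT μ
    refine (add_le_add h1 ih).trans ?_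
    rw [← mul_add]
    gcongr
    rw [← ENNReal.coe_add, ENNReal.coe_le_coe, NNReal.mul_rpow (x := 2)]
    calc (2 : ℝ≥0) ^ β * (2 ^ I * δ) ^ β + κ * (2 ^ I * δ) ^ β
        = (κ * (2 ^ β)⁻¹ + 1) * (2 ^ β * (2 ^ I * δ) ^ β) := by
          have : (2 : ℝ≥0) ^ β ≠ 0 := by simp
          field_simp
          ring
      _ ≤ κ * (2 ^ β * (2 ^ I * δ) ^ β) := by gcongr

/-- The distance between an arbitrary scheme and the scheme of a sufficiently fine grid. -/
lemma SchemeEstimate.run_grid (hp : 1 ≤ p) (hE : SchemeEstimate Θ β T M) (hβ : 0 ≤ β)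
    (hA : IsPart s t A)
    (hT : t ≤ T) (hδ : 0 < δ) (hκ : κ * (2 ^ β)⁻¹ + 1 ≤ κ) (hfine : IsFine h s t A)
    (hδh : δ ≤ h) (hsep : ∀ x ∈ A, ∀ y ∈ A, x < y → x + δ < y) (μ : PSpace p H) :
    W (run Θ A μ) (run Θ (grid δ s t) μ) ≤
      2 * M * (1 + μ.norm) * ((t - s) ^ (1 / 2 : ℝ) : ℝ≥0) *
        (((1 + κ * 2 ^ β) * h ^ β + δ ^ β : ℝ≥0)) := by
  -- `2 ^ n * δ ≤ h < 2 ^ (n + 1) * δ`: the starting grid is just coarser than `A`, so inserting it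
  -- is simple, yet its mesh is at most `2 * h`, so the chain costs a multiple of `h ^ β`.
  obtain ⟨n, hn1, hn2⟩ := exists_nat_pow_near ((one_le_div₀ hδ).2 hδh)
    (one_lt_two : (1 : ℝ≥0) < 2)
  rw [le_div_iff₀ hδ] at hn1
  rw [div_lt_iff₀ hδ] at hn2
  have hG := isPart_grid hδ hA.le
  have hG' := isPart_grid (pos_of_gt hn2) hA.le
  have h1 := hE.insertion hA (hA.union hG') (hfine.simpleInsertion_grid hA hn2) hfine hT μ
  have h2 := hE.grid_chain hp hA hT hδ hκ μ (n + 1)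
  -- The last leg removes `A`: its points are more than `δ` apart, so they form a simple insertion
  -- into the grid.
  have h3 := hE.insertion hG (hG.union hA) (simpleInsertion_grid_union hδ hA hsep)
    (isFine_grid hδ) hT μ
  rw [W_comm, Finset.union_comm] at h3
  refine (W_triangle hp _ (run Θ (A ∪ grid (2 ^ (n + 1) * δ) s t) μ) _).trans ?_
  refine (add_le_add h1 (W_triangle hp _ (run Θ (A ∪ grid δ s t) μ) _)).trans ?_
  refine (add_le_add le_rfl (add_le_add h2 h3)).trans ?_
  rw [← mul_add, ← mul_add]
  gcongr
  rw [← ENNReal.coe_add, ← ENNReal.coe_add, ENNReal.coe_le_coe]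
  have h4 : (2 ^ (n + 1) * δ) ^ β ≤ 2 ^ β * h ^ β := by
    rw [← NNReal.mul_rpow]
    refine NNReal.rpow_le_rpow ?_ hβ
    calc 2 ^ (n + 1) * δ = 2 * (2 ^ n * δ) := by ring
      _ ≤ 2 * h := by gcongr
  calc h ^ β + (κ * (2 ^ (n + 1) * δ) ^ β + δ ^ β) ≤ h ^ β + (κ * (2 ^ β * h ^ β) + δ ^ β) := by
        gcongr
    _ = _ := by ring

end Estimates

/-! ### Dyadic schemes as schemes of grids -/

section Dyadic

/-- The mesh `2^{-n}` of the dyadic grid. -/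
noncomputable def dyad (n : ℕ) : ℝ≥0 := (2 ^ n)⁻¹

/-- The largest point of the dyadic grid of mesh `2^{-n}` that is at most `s`. -/
noncomputable def dyadFloor (n : ℕ) (s : ℝ≥0) : ℝ≥0 := ⌊2 ^ n * s⌋₊ * dyad n

lemma dyad_pos (n : ℕ) : 0 < dyad n := by unfold dyad; positivity

lemma dyad_succ (n : ℕ) : dyad n = 2 * dyad (n + 1) := by
  unfold dyad
  rw [pow_succ]
  field_simp

lemma tendsto_dyad : Tendsto dyad atTop (𝓝 0) := by
  have h := tendsto_pow_atTop_nhds_zero_of_lt_one (r := (2⁻¹ : ℝ≥0)) zero_le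
    (by rw [← NNReal.coe_lt_coe]; norm_num)
  simp only [inv_pow] at h
  exact h

lemma dyadFloor_le (n : ℕ) (s : ℝ≥0) : dyadFloor n s ≤ s := by
  rw [dyadFloor, dyad, ← div_eq_mul_inv, div_le_iff₀' (by positivity)]
  exact Nat.floor_le zero_le

lemma lt_dyadFloor_add (n : ℕ) (s : ℝ≥0) : s < dyadFloor n s + dyad n := by
  have h : dyadFloor n s + dyad n = (⌊2 ^ n * s⌋₊ + 1 : ℝ≥0) / 2 ^ n := by
    rw [dyadFloor, dyad, add_div, div_eq_mul_inv, one_div]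
  rw [h, lt_div_iff₀' (by positivity)]
  exact Nat.lt_floor_add_one _

lemma mul_dyad_le_dyadFloor {n k : ℕ} {s : ℝ≥0} (h : k * dyad n ≤ s) :
    k * dyad n ≤ dyadFloor n s := by
  unfold dyadFloor
  gcongr
  refine Nat.le_floor ?_
  rwa [dyad, ← div_eq_mul_inv, div_le_iff₀' (by positivity)] at h

lemma dyadFloor_mono {n : ℕ} {s t : ℝ≥0} (h : s ≤ t) : dyadFloor n s ≤ dyadFloor n t :=
  mul_dyad_le_dyadFloor ((dyadFloor_le n s).trans h)

variable {E : Type*} {Θ : ℝ≥0 → ℝ≥0 → E → E}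

lemma dyadicScheme_eq_run (hΘ : ∀ t, Θ t t = id) (n : ℕ) {s t : ℝ≥0} (hst : s ≤ t) (μ : E) :
    dyadicScheme Θ n s t μ = run Θ (grid (dyad n) (dyadFloor n s) (dyadFloor n t)) μ := by
  have hab : ⌊2 ^ n * s⌋₊ ≤ ⌊2 ^ n * t⌋₊ := Nat.floor_mono (by gcongr)
  rw [dyadicScheme, (compose_eq_run hΘ _ μ).2]
  · congr 1
    ext x
    rw [mem_grid (dyad_pos n)]
    simp only [Finset.mem_image, Finset.mem_range, div_eq_mul_inv]
    change (∃ a, _ ∧ _ * dyad n = x) ↔ _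
    constructor
    · rintro ⟨k, hk, rfl⟩
      refine Or.inr (Or.inr ⟨_, rfl, ?_, ?_⟩) <;> unfold dyadFloor <;> gcongr <;> omega
    · rintro (rfl | rfl | ⟨k, rfl, h1, h2⟩)
      · exact ⟨0, by omega, by simp [dyadFloor]⟩
      · exact ⟨⌊2 ^ n * t⌋₊ - ⌊2 ^ n * s⌋₊, by omega, by rw [Nat.add_sub_cancel' hab]; rfl⟩
      · unfold dyadFloor at h1 h2
        have h1 := le_of_mul_le_mul_right h1 (dyad_pos n)
        have h2 := le_of_mul_le_mul_right h2 (dyad_pos n)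
        rw [Nat.cast_le] at h1 h2
        exact ⟨k - ⌊2 ^ n * s⌋₊, by omega, by rw [Nat.add_sub_cancel' h1]⟩
  · intro i _
    gcongr
    omega

lemma compose_add (τ : ℕ → ℝ≥0) (M N : ℕ) (μ : E) :
    compose Θ τ (M + N) μ = compose Θ (fun k => τ (M + k)) N (compose Θ τ M μ) := by
  induction N with
  | zero => rfl
  | succ N ih => rw [← add_assoc, compose, compose, ih]; rfl

lemma dyadicScheme_comp (n : ℕ) {s r t : ℝ≥0} (hsr : s ≤ r) (hrt : r ≤ t) (μ : E) :
    dyadicScheme Θ n s t μ = dyadicScheme Θ n r t (dyadicScheme Θ n s r μ) := by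
  have hab : ⌊2 ^ n * s⌋₊ ≤ ⌊2 ^ n * r⌋₊ := Nat.floor_mono (by gcongr)
  have hbc : ⌊2 ^ n * r⌋₊ ≤ ⌊2 ^ n * t⌋₊ := Nat.floor_mono (by gcongr)
  unfold dyadicScheme
  rw [show ⌊2 ^ n * t⌋₊ - ⌊2 ^ n * s⌋₊ =
    (⌊2 ^ n * r⌋₊ - ⌊2 ^ n * s⌋₊) + (⌊2 ^ n * t⌋₊ - ⌊2 ^ n * r⌋₊) by omega, compose_add]
  congr 1
  ext k
  rw [← add_assoc, Nat.add_sub_cancel' hab]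

lemma dyadicScheme_self (n : ℕ) (s : ℝ≥0) (μ : E) : dyadicScheme Θ n s s μ = μ := by
  simp [dyadicScheme, compose]

end Dyadic

/-! ### Convergence of the dyadic schemes and the limit flow -/

section Limit

variable {p : ℝ≥0} {H : Type*} [NormedAddCommGroup H] [InnerProductSpace ℝ H] [CompleteSpace H]
  [SecondCountableTopology H] [MeasurableSpace H] [BorelSpace H]
  {Θ : ℝ≥0 → ℝ≥0 → PSpace p H → PSpace p H} {β : ℝ} {T M s r t h δ κ : ℝ≥0}
  {A B : Finset ℝ≥0}

lemma tendsto_dyad_rpow (hβ : 0 < β) : Tendsto (fun n => dyad n ^ β) atTop (𝓝 0) := by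
  have := tendsto_dyad.nnrpow (tendsto_const_nhds (x := β)) (Or.inr hβ)
  rwa [NNReal.zero_rpow hβ.ne'] at this

lemma PSpace.one_add_norm_ne_top (μ : PSpace p H) : 1 + μ.norm ≠ ∞ :=
  ENNReal.add_ne_top.2 ⟨ENNReal.one_ne_top, μ.norm_ne_top⟩

lemma SchemeEstimate.one_add_norm_dyadicScheme_le (hE : SchemeEstimate Θ β T M)
    (hΘ : ∀ t, Θ t t = id) (hst : s ≤ t) (hT : t ≤ T) (n : ℕ) (μ : PSpace p H) :
    1 + (dyadicScheme Θ n s t μ).norm ≤ M * (1 + μ.norm) := by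
  rw [dyadicScheme_eq_run hΘ n hst]
  exact hE.norm_le (isPart_grid (dyad_pos n) (dyadFloor_mono hst)) ((dyadFloor_le n t).trans hT) μ

/-- The dyadic schemes are asymptotically stable in the initial measure. -/
lemma SchemeEstimate.tendsto_dyadicScheme (hE : SchemeEstimate Θ β T M)
    (hΘ : ∀ t, Θ t t = id) (hβ : 0 < β) (hst : s ≤ t) (hT : t ≤ T) {ν : PSpace p H}
    {μ : ℕ → PSpace p H} {b : ℝ≥0∞} (hb : b ≠ ∞) (hμb : ∀ n, (μ n).norm ≤ b)
    (hμ : Tendsto (fun n => W (μ n) ν) atTop (𝓝 0)) :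
    Tendsto (fun n => W (dyadicScheme Θ n s t (μ n)) (dyadicScheme Θ n s t ν)) atTop (𝓝 0) := by
  have hle : ∀ n, W (dyadicScheme Θ n s t (μ n)) (dyadicScheme Θ n s t ν) ≤
      M * (W (μ n) ν + (1 + (b + ν.norm)) * (T ^ (1 / 2 : ℝ) * dyad n ^ β : ℝ≥0)) := by
    intro n
    rw [dyadicScheme_eq_run hΘ n hst, dyadicScheme_eq_run hΘ n hst]
    have hG := isPart_grid (dyad_pos n) (dyadFloor_mono (n := n) hst)
    refine (hE.stable hG hG ⟨Finset.Subset.rfl, fun x hx hx' => absurd hx hx'⟩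
      (isFine_grid (dyad_pos n)) ((dyadFloor_le n t).trans hT) _ _).trans ?_
    have h1 : dyadFloor n t - dyadFloor n s ≤ T :=
      tsub_le_self.trans ((dyadFloor_le n t).trans hT)
    have := hμb n
    gcongr
  refine tendsto_of_tendsto_of_tendsto_of_le_of_le tendsto_const_nhds ?_ (fun _ => zero_le) hle
  have h1 : Tendsto (fun n => T ^ (1 / 2 : ℝ) * dyad n ^ β) atTop (𝓝 0) := by
    simpa using (tendsto_dyad_rpow hβ).const_mul (T ^ (1 / 2 : ℝ))
  have h2 := ENNReal.Tendsto.const_mul (a := 1 + (b + ν.norm)) (ENNReal.tendsto_coe.2 h1)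
    (Or.inr (ENNReal.add_ne_top.2 ⟨ENNReal.one_ne_top, ENNReal.add_ne_top.2 ⟨hb, ν.norm_ne_top⟩⟩))
  have h3 := ENNReal.Tendsto.const_mul (a := (M : ℝ≥0∞)) (hμ.add h2) (Or.inr ENNReal.coe_ne_top)
  simpa using h3

lemma W_step_le {φ : ℝ≥0 → ℝ≥0} (hφ : Monotone φ)
    (hC : ∀ s t : ℝ≥0, s < t → ∀ μ : PSpace p H, W (Θ s t μ) μ ≤ (1 + μ.norm) * φ (t - s))
    (hΘ : ∀ t, Θ t t = id) (hst : s ≤ t) (hδ : t ≤ s + δ) (μ : PSpace p H) :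
    W (Θ s t μ) μ ≤ (1 + μ.norm) * φ δ := by
  rcases hst.eq_or_lt with rfl | hlt
  · rw [hΘ, id, W_self]
    exact zero_le
  · refine (hC s t hlt μ).trans ?_
    gcongr
    exact hφ (tsub_le_iff_left.2 hδ)

/-- Passing from the dyadic grid with rounded endpoints to the grid with exact endpoints. -/
lemma SchemeEstimate.W_dyadicScheme_run_le (hp : 1 ≤ p) (hE : SchemeEstimate Θ β T M)
    (hΘ : ∀ t, Θ t t = id) {φ : ℝ≥0 → ℝ≥0} (hφ : Monotone φ)
    (hC : ∀ s t : ℝ≥0, s < t → ∀ μ : PSpace p H, W (Θ s t μ) μ ≤ (1 + μ.norm) * φ (t - s))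
    (hst : s < t) (hT : t ≤ T) (n : ℕ) (μ : PSpace p H) :
    W (dyadicScheme Θ n s t μ) (run Θ (grid (dyad n) s t) μ) ≤
      M * (1 + μ.norm) * (2 * φ (dyad n) +
        (3 + M) * (T ^ (1 / 2 : ℝ) * dyad n ^ β : ℝ≥0)) := by
  set δ := dyad n with hδ
  have hδ0 : 0 < δ := dyad_pos n
  set s' := dyadFloor n s with hs'
  set t' := dyadFloor n t with ht'
  have hs's : s' ≤ s := dyadFloor_le n s
  have ht't : t' ≤ t := dyadFloor_le n t
  have hss' : s ≤ s' + δ := (lt_dyadFloor_add n s).le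
  have htt' : t ≤ t' + δ := (lt_dyadFloor_add n t).le
  have hQ : IsPart s' t' (grid δ s' t') := isPart_grid hδ0 (dyadFloor_mono hst.le)
  -- Three moves: append a final step from `t'` to `t` (cost `φ δ`), insert `s` (one simple
  -- insertion), then cut at `s`. After the cut the scheme on `[s, t]` starts from `Θ s' s μ` rather
  -- than `μ`, again a `φ δ` error.
  set A := insert t (grid δ s' t') with hA
  have hAp : IsPart s' t A := hQ.insert_right ht't
  have hAf : IsFine δ s' t A := (isFine_grid hδ0).insert_right htt'
  set B := insert s A with hB
  have hBp : IsPart s' t B := by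
    refine ⟨Finset.mem_insert_of_mem hAp.left_mem, Finset.mem_insert_of_mem hAp.right_mem, ?_, ?_⟩
    · intro x hx
      rcases Finset.mem_insert.1 hx with rfl | hx
      exacts [hs's, hAp.left_le x hx]
    · intro x hx
      rcases Finset.mem_insert.1 hx with rfl | hx
      exacts [hst.le, hAp.le_right x hx]
  have hAB : SimpleInsertion A B := by
    refine ⟨Finset.subset_insert _ _, fun x hx hxA y hy hyA hxy => ?_⟩
    have h1 := (Finset.mem_insert.1 hx).resolve_right hxA
    have h2 := (Finset.mem_insert.1 hy).resolve_right hyA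
    exact absurd hxy (by rw [h1, h2]; exact lt_irrefl _)
  have hmemB : ∀ x, x ∈ B ↔ x = s ∨ x = t ∨ x = s' ∨ x = t' ∨
      ∃ k : ℕ, k * δ = x ∧ s' ≤ x ∧ x ≤ t' := fun x => by
    rw [hB, hA, Finset.mem_insert, Finset.mem_insert, mem_grid hδ0]
  -- No multiple of `δ` lies in `(s', s]`, by the choice of `s'`.
  have hBle : B.filter (· ≤ s) = insert s {s'} := by
    ext x
    rw [Finset.mem_filter, hmemB, Finset.mem_insert, Finset.mem_singleton]
    constructor
    · rintro ⟨hx, hxs⟩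
      rcases hx with rfl | rfl | rfl | rfl | ⟨k, rfl, h1, -⟩
      · exact Or.inl rfl
      · exact absurd hst hxs.not_gt
      · exact Or.inr rfl
      · exact Or.inr (le_antisymm (mul_dyad_le_dyadFloor hxs) hQ.le)
      · exact Or.inr (le_antisymm (mul_dyad_le_dyadFloor hxs) h1)
    · rintro (rfl | rfl)
      · exact ⟨Or.inl rfl, le_rfl⟩
      · exact ⟨Or.inr (Or.inr (Or.inl rfl)), hs's⟩
  have hBge : B.filter (s ≤ ·) = grid δ s t := by
    ext x
    rw [Finset.mem_filter, hmemB, mem_grid hδ0]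
    constructor
    · rintro ⟨hx, hsx⟩
      rcases hx with rfl | rfl | rfl | rfl | ⟨k, rfl, h1, h2⟩
      · exact Or.inl rfl
      · exact Or.inr (Or.inl rfl)
      · exact Or.inl (le_antisymm hs's hsx)
      · exact Or.inr (Or.inr ⟨_, rfl, hsx, ht't⟩)
      · exact Or.inr (Or.inr ⟨k, rfl, hsx, h2.trans ht't⟩)
    · rintro (rfl | rfl | ⟨k, rfl, h1, h2⟩)
      · exact ⟨Or.inl rfl, le_rfl⟩
      · exact ⟨Or.inr (Or.inl rfl), hst.le⟩
      · exact ⟨Or.inr (Or.inr (Or.inr (Or.inr ⟨k, rfl, hs's.trans h1,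
          mul_dyad_le_dyadFloor h2⟩))), h1⟩
  have hsB : s ∈ B := Finset.mem_insert_self _ _
  have hins : IsPart s' s (insert s {s'}) := (isPart_singleton s').insert_right hs's
  have hstep : run Θ (insert s {s'}) μ = Θ s' s μ := by
    rw [run_insert_of_le hΘ (isPart_singleton s') hs's, run_singleton]
  have hnorm := hE.norm_le hins (hst.le.trans hT) μ
  rw [hstep] at hnorm
  have hG := isPart_grid hδ0 hst.le
  have e1 : W (dyadicScheme Θ n s t μ) (run Θ A μ) ≤ M * (1 + μ.norm) * φ δ := by
    rw [dyadicScheme_eq_run hΘ n hst.le, W_comm, hA, run_insert_of_le hΘ hQ ht't]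
    refine (W_step_le hφ hC hΘ ht't htt' _).trans ?_
    gcongr
    exact hE.norm_le hQ (ht't.trans hT) μ
  have hT1 : t - s' ≤ T := tsub_le_self.trans hT
  have hT2 : t - s ≤ T := tsub_le_self.trans hT
  have e2 : W (run Θ A μ) (run Θ B μ) ≤
      2 * M * (1 + μ.norm) * (T ^ (1 / 2 : ℝ) : ℝ≥0) * (δ ^ β : ℝ≥0) := by
    refine (hE.insertion hAp hBp hAB hAf hT μ).trans ?_
    gcongr
  have e3 : W (run Θ B μ) (run Θ (grid δ s t) μ) ≤ M * ((1 + μ.norm) * φ δ +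
      (M + 1) * (1 + μ.norm) * (T ^ (1 / 2 : ℝ) * δ ^ β : ℝ≥0)) := by
    rw [run_eq_run_run hBp hsB, hBle, hBge, hstep]
    refine (hE.stable hG hG ⟨Finset.Subset.rfl, fun x hx hx' => absurd hx hx'⟩
      (isFine_grid hδ0) hT _ _).trans ?_
    have h1 := W_step_le hφ hC hΘ hs's hss' μ
    have h2 : 1 + ((Θ s' s μ).norm + μ.norm) ≤ (M + 1) * (1 + μ.norm) := by
      rw [← add_assoc, add_mul, one_mul]
      exact add_le_add hnorm le_add_self
    gcongr
  refine (W_triangle hp _ (run Θ A μ) _).trans ?_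
  refine (add_le_add e1 ((W_triangle hp _ (run Θ B μ) _).trans (add_le_add e2 e3))).trans ?_
  apply le_of_eq
  rw [ENNReal.coe_mul]
  ring

lemma SchemeEstimate.tendsto_dyadicScheme_run (hp : 1 ≤ p) (hE : SchemeEstimate Θ β T M)
    (hΘ : ∀ t, Θ t t = id) (hβ : 0 < β) (hC : ContinuityProperty Θ)
    (hst : s < t) (hT : t ≤ T) (μ : PSpace p H) :
    Tendsto (fun n => W (dyadicScheme Θ n s t μ) (run Θ (grid (dyad n) s t) μ)) atTop (𝓝 0) := by
  obtain ⟨φ, hφ, hφ0, hC⟩ := hC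
  refine tendsto_of_tendsto_of_tendsto_of_le_of_le tendsto_const_nhds ?_ (fun _ => zero_le)
    (fun n => hE.W_dyadicScheme_run_le hp hΘ hφ hC hst hT n μ)
  have h0 : Tendsto dyad atTop (𝓝[>] 0) :=
    tendsto_nhdsWithin_iff.2 ⟨tendsto_dyad, Eventually.of_forall dyad_pos⟩
  have h1 : Tendsto (fun n => T ^ (1 / 2 : ℝ) * dyad n ^ β) atTop (𝓝 0) := by
    simpa using (tendsto_dyad_rpow hβ).const_mul (T ^ (1 / 2 : ℝ))
  have h2 := ENNReal.Tendsto.const_mul (a := (3 + M : ℝ≥0∞)) (ENNReal.tendsto_coe.2 h1)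
    (Or.inr (by simp))
  have h3 := ENNReal.Tendsto.const_mul (a := (2 : ℝ≥0∞)) (ENNReal.tendsto_coe.2 (hφ0.comp h0))
    (Or.inr (by simp))
  have h4 := ENNReal.Tendsto.const_mul (a := M * (1 + μ.norm)) (h3.add h2)
    (Or.inr (ENNReal.mul_ne_top ENNReal.coe_ne_top μ.one_add_norm_ne_top))
  simpa using h4

/-- On grids with the exact endpoints, successive distances decay like `2^{-nβ}` and are summable.
The rounded schemes need not have summable increments, since `φ` has no rate; they are compared with
the grids only in the limit. -/
lemma SchemeEstimate.exists_limit (hp : 1 ≤ p) (hE : SchemeEstimate Θ β T M)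
    (hΘ : ∀ t, Θ t t = id) (hβ : 0 < β) (hC : ContinuityProperty Θ)
    (hst : s < t) (hT : t ≤ T) (μ : PSpace p H) :
    ∃ ν, Tendsto (fun n => W (dyadicScheme Θ n s t μ) ν) atTop (𝓝 0) := by
  have hle : ∀ n, W (run Θ (grid (dyad n) s t) μ) (run Θ (grid (dyad (n + 1)) s t) μ) ≤
      2 * M * (1 + μ.norm) * ((t - s) ^ (1 / 2 : ℝ) : ℝ≥0) * (((2 ^ β)⁻¹ : ℝ≥0) : ℝ≥0∞) ^ n := by
    intro n
    have hins := simpleInsertion_grid_two (dyad_pos (n + 1)) hst.le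
    rw [← dyad_succ] at hins
    refine (hE.insertion (isPart_grid (dyad_pos n) hst.le) (isPart_grid (dyad_pos (n + 1)) hst.le)
      hins (isFine_grid (dyad_pos n)) hT μ).trans (le_of_eq ?_)
    congr 1
    rw [← ENNReal.coe_pow, dyad, NNReal.inv_rpow, inv_pow, ← NNReal.rpow_natCast,
      ← NNReal.rpow_natCast, ← NNReal.rpow_mul, ← NNReal.rpow_mul, mul_comm]
  have hlt : (((2 ^ β)⁻¹ : ℝ≥0) : ℝ≥0∞) < 1 := by
    rw [← ENNReal.coe_one, ENNReal.coe_lt_coe]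
    exact inv_lt_one_of_one_lt₀ (NNReal.one_lt_rpow one_lt_two hβ)
  obtain ⟨ν, hν⟩ := WassersteinSewing.exists_limit hp (fun n => run Θ (grid (dyad n) s t) μ) (by
    refine ne_top_of_le_ne_top ?_ (ENNReal.tsum_le_tsum hle)
    rw [ENNReal.tsum_mul_left, ENNReal.tsum_geometric]
    refine ENNReal.mul_ne_top (ENNReal.mul_ne_top (ENNReal.mul_ne_top
      (ENNReal.mul_ne_top (by simp) ENNReal.coe_ne_top) μ.one_add_norm_ne_top) ENNReal.coe_ne_top) ?_
    rw [ENNReal.inv_ne_top]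
    exact (tsub_pos_of_lt hlt).ne')
  refine ⟨ν, ?_⟩
  have h := (hE.tendsto_dyadicScheme_run hp hΘ hβ hC hst hT μ).add hν
  rw [add_zero] at h
  exact tendsto_of_tendsto_of_tendsto_of_le_of_le tendsto_const_nhds h (fun _ => zero_le)
    fun n => W_triangle hp _ _ _

lemma eq_of_tendsto_W (hp : 1 ≤ p) {μ ν : PSpace p H} {m m' : ℕ → PSpace p H}
    (h : Tendsto (fun n => W (m n) (m' n)) atTop (𝓝 0))
    (h₁ : Tendsto (fun n => W (m n) μ) atTop (𝓝 0))
    (h₂ : Tendsto (fun n => W (m' n) ν) atTop (𝓝 0)) : μ = ν := by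
  refine eq_of_W_eq_zero hp (le_antisymm ?_ zero_le)
  have h3 := h₁.add (h.add h₂)
  rw [add_zero, add_zero] at h3
  refine ge_of_tendsto h3 (Eventually.of_forall fun n => ?_)
  refine (W_triangle hp _ (m n) _).trans (add_le_add (W_comm _ _).le ?_)
  exact W_triangle hp _ _ _

/-- Dyadic schemes compose exactly, even at non-dyadic times, because the rounded endpoints match.
Asymptotic stability carries this to the limit, where uniqueness of limits in `W` gives equality. -/
lemma exists_isLimitFlow (hp : 1 ≤ p) (hE : ∀ T, ∃ M, SchemeEstimate Θ β T M)
    (hΘ : ∀ t, Θ t t = id) (hβ : 0 < β) (hC : ContinuityProperty Θ) :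
    ∃ θ : ℝ≥0 → ℝ≥0 → PSpace p H → PSpace p H, IsLimitFlow Θ θ := by
  have hex : ∀ s t μ, ∃ ν : PSpace p H, s ≤ t →
      Tendsto (fun n => W (dyadicScheme Θ n s t μ) ν) atTop (𝓝 0) := by
    intro s t μ
    by_cases hst : s ≤ t
    · rcases hst.eq_or_lt with rfl | hlt
      -- The identity on the diagonal, so that the flow property also holds when two times coincide.
      · refine ⟨μ, fun _ => ?_⟩
        simp only [dyadicScheme_self, W_self]
        exact tendsto_const_nhds
      · obtain ⟨M, hM⟩ := hE t
        obtain ⟨ν, hν⟩ := hM.exists_limit hp hΘ hβ hC hlt le_rfl μ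
        exact ⟨ν, fun _ => hν⟩
    · exact ⟨μ, fun h => absurd h hst⟩
  choose θ hθ using hex
  refine ⟨θ, fun s r t hsr hrt => ?_, fun s t hst μ => hθ s t μ hst.le⟩
  ext1 μ
  obtain ⟨M, hM⟩ := hE t
  have h1 := hM.tendsto_dyadicScheme hΘ hβ hrt le_rfl
    (ENNReal.mul_ne_top ENNReal.coe_ne_top μ.one_add_norm_ne_top)
    (fun n => le_add_self.trans (hM.one_add_norm_dyadicScheme_le hΘ hsr hrt n μ)) (hθ s r μ hsr)
  simp only [← dyadicScheme_comp _ hsr hrt] at h1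
  exact eq_of_tendsto_W hp h1 (hθ s t μ (hsr.trans hrt)) (hθ r t _ hrt)

/-- From `A` to the grid of mesh `dyad n`, then to the dyadic scheme, then to `ν`; as `n → ∞` only
the term in `h ^ β` survives. Any dyadic limit `ν` is allowed, so the bound applies to every limit
flow. -/
lemma SchemeEstimate.W_run_limit_le (hp : 1 ≤ p) (hE : SchemeEstimate Θ β T M)
    (hΘ : ∀ t, Θ t t = id) (hβ : 0 < β) (hC : ContinuityProperty Θ)
    (hκ : κ * (2 ^ β)⁻¹ + 1 ≤ κ) (hst : s < t) (hT : t ≤ T)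
    (hA : IsPart s t A) (hfine : IsFine h s t A) (hh : 0 < h) {μ ν : PSpace p H}
    (hν : Tendsto (fun n => W (dyadicScheme Θ n s t μ) ν) atTop (𝓝 0)) :
    W (run Θ A μ) ν ≤ (2 * M * (1 + κ * 2 ^ β) : ℝ≥0) * (1 + μ.norm) *
      ((t - s) ^ (1 / 2 : ℝ) : ℝ≥0) * (h ^ β : ℝ≥0) := by
  set c : ℝ≥0∞ := 2 * M * (1 + μ.norm) * ((t - s) ^ (1 / 2 : ℝ) : ℝ≥0) with hc
  have hcT : c ≠ ∞ := ENNReal.mul_ne_top (ENNReal.mul_ne_top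
    (ENNReal.mul_ne_top (by simp) ENNReal.coe_ne_top) μ.one_add_norm_ne_top) ENNReal.coe_ne_top
  have hbound : ∀ᶠ n in atTop, W (run Θ A μ) ν ≤
      c * (((1 + κ * 2 ^ β) * h ^ β + dyad n ^ β : ℝ≥0)) +
        (W (dyadicScheme Θ n s t μ) (run Θ (grid (dyad n) s t) μ) +
          W (dyadicScheme Θ n s t μ) ν) := by
    filter_upwards [tendsto_dyad.eventually (eventually_add_lt A),
      tendsto_dyad.eventually (ge_mem_nhds hh)] with n hsep hδh
    refine (W_triangle hp _ (run Θ (grid (dyad n) s t) μ) _).trans (add_le_add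
      (hE.run_grid hp hβ.le hA hT (dyad_pos n) hκ hfine hδh hsep μ) ?_)
    refine (W_triangle hp _ (dyadicScheme Θ n s t μ) _).trans ?_
    rw [W_comm]
  have h1 : Tendsto (fun n => (1 + κ * 2 ^ β) * h ^ β + dyad n ^ β) atTop
      (𝓝 ((1 + κ * 2 ^ β) * h ^ β + 0)) := (tendsto_dyad_rpow hβ).const_add _
  have h2 := (ENNReal.Tendsto.const_mul (ENNReal.tendsto_coe.2 h1) (Or.inr hcT)).add
    ((hE.tendsto_dyadicScheme_run hp hΘ hβ hC hst hT μ).add hν)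
  refine (ge_of_tendsto h2 hbound).trans (le_of_eq ?_)
  rw [hc]
  push_cast
  ring

end Limit

/-! ### Partitions as finite sets -/

section Partitions

variable {s t : ℝ≥0}

lemma Partition.isFine (π : Partition s t) :
    IsFine π.mesh s t ((Finset.range (π.N + 1)).image π.pt) := by
  have key : ∀ N ≤ π.N, ∀ x, π.pt 0 ≤ x → x < π.pt N →
      ∃ i < N, x < π.pt (i + 1) ∧ π.pt i ≤ x := by
    intro N
    induction N with
    | zero => exact fun _ x h1 h2 => absurd h1 h2.not_ge
    | succ N ih =>
      intro hN x h1 h2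
      rcases lt_or_ge x (π.pt N) with h | h
      · obtain ⟨i, hi, h⟩ := ih (by omega) x h1 h
        exact ⟨i, by omega, h⟩
      · exact ⟨N, by omega, h2, h⟩
  intro x hsx hxt
  obtain ⟨i, hi, h1, h2⟩ := key π.N le_rfl x (by rwa [π.pt_zero]) (by rwa [π.pt_last])
  refine ⟨π.pt (i + 1), Finset.mem_image_of_mem _ (by simpa using hi), h1, ?_⟩
  have h3 : π.pt (i + 1) - π.pt i ≤ π.mesh :=
    Finset.le_sup (f := fun i => π.pt (i + 1) - π.pt i) (Finset.mem_range.2 hi)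
  calc π.pt (i + 1) ≤ π.pt i + π.mesh := tsub_le_iff_left.1 h3
    _ ≤ x + π.mesh := by gcongr

lemma Partition.mesh_pos (π : Partition s t) (hst : s < t) : 0 < π.mesh := by
  obtain ⟨y, -, h1, h2⟩ := π.isFine s le_rfl hst
  by_contra! h
  rw [le_antisymm h zero_le, add_zero] at h2
  exact h1.not_ge h2

/-- The partition of `[s, t]` without interior points. -/
def Partition.trivial (hst : s < t) : Partition s t where
  N := 1
  pt := fun i => if i = 0 then s else t
  pt_zero := by simp
  pt_last := by simp
  pt_lt := by simp [hst]

end Partitions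

end WassersteinSewing

theorem theorem2p7 (p : ℝ≥0) (hp : 2 ≤ p) (β : ℝ) (hβ : 0 < β) (T : ℝ≥0) (hT : 0 < T)
    (L C : ℝ≥0) (hL : 0 < L) (hC : 0 < C) :
    ∃ C' : ℝ≥0,
      ∀ (H : Type u) [NormedAddCommGroup H] [InnerProductSpace ℝ H] [CompleteSpace H]
        [TopologicalSpace.SeparableSpace H] [MeasurableSpace H] [BorelSpace H]
        (Ω : Type v) [mΩ : MeasurableSpace Ω] (P : Measure Ω) [IsProbabilityMeasure P]
        (ℱ : Filtration ℝ≥0 mΩ) (Θ : ℝ≥0 → ℝ≥0 → PSpace p H → PSpace p H),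
        Atomless ℱ P → (∀ t : ℝ≥0, Θ t t = id) → SewingProperty ℱ P Θ β L C →
        ContinuityProperty Θ →
        (∃ θ : ℝ≥0 → ℝ≥0 → PSpace p H → PSpace p H, IsLimitFlow Θ θ) ∧
        ∀ θ : ℝ≥0 → ℝ≥0 → PSpace p H → PSpace p H, IsLimitFlow Θ θ →
          ∀ s t : ℝ≥0, s < t → t ≤ T → ∀ μ : PSpace p H,
            (∀ π : Partition s t, W (scheme Θ π μ) (θ s t μ) ≤
              C' * (1 + μ.norm) * ((t - s) ^ (1 / 2 : ℝ) : ℝ≥0) * (π.mesh ^ β : ℝ≥0)) ∧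
            W (Θ s t μ) (θ s t μ) ≤
              C' * (1 + μ.norm) * ((t - s) ^ (1 / 2 + β) : ℝ≥0) := by
  have hp1 : 1 ≤ p := one_le_two.trans hp
  -- A limit flow lives on all times, so its existence uses every horizon; the constant comes from
  -- `T` alone.
  have hM := fun T => exists_schemeEstimate.{u, v} hp hβ T L C
  obtain ⟨M, hMT⟩ := hM T
  have h2β : (2 ^ β)⁻¹ < (1 : ℝ≥0) := inv_lt_one_of_one_lt₀ (NNReal.one_lt_rpow one_lt_two hβ)
  obtain ⟨κ, hκ⟩ : ∃ κ : ℝ≥0, κ * (2 ^ β)⁻¹ + 1 ≤ κ := by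
    -- The sum of the geometric series of ratio `2^{-β}`.
    refine ⟨(1 - (2 ^ β)⁻¹)⁻¹, le_of_eq ?_⟩
    have h0 : 1 - ((2 : ℝ≥0) ^ β)⁻¹ ≠ 0 := (tsub_pos_of_lt h2β).ne'
    have h1 : ((2 : ℝ≥0) ^ β)⁻¹ + (1 - (2 ^ β)⁻¹) = 1 := add_tsub_cancel_of_le h2β.le
    generalize 1 - ((2 : ℝ≥0) ^ β)⁻¹ = y at h0 h1
    calc y⁻¹ * (2 ^ β)⁻¹ + 1 = y⁻¹ * ((2 ^ β)⁻¹ + y) := by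
          rw [mul_add, inv_mul_cancel₀ h0]
      _ = y⁻¹ := by rw [h1, mul_one]
  refine ⟨2 * M * (1 + κ * 2 ^ β), fun H _ _ _ _ _ _ Ω _ P _ ℱ Θ hA hΘ hS hCP => ?_⟩
  have : SecondCountableTopology H := UniformSpace.secondCountable_of_separable H
  have hE := hMT H Ω P ℱ Θ hA hΘ hS
  refine ⟨exists_isLimitFlow hp1 (fun T => (hM T).imp fun M h => h H Ω P ℱ Θ hA hΘ hS) hΘ hβ hCP,
    fun θ hθ s t hst htT μ => ?_⟩
  have key : ∀ π : Partition s t, W (scheme Θ π μ) (θ s t μ) ≤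
      (2 * M * (1 + κ * 2 ^ β) : ℝ≥0) * (1 + μ.norm) * ((t - s) ^ (1 / 2 : ℝ) : ℝ≥0) *
        (π.mesh ^ β : ℝ≥0) := by
    intro π
    obtain ⟨h1, h2⟩ := compose_eq_run hΘ (τ := π.pt) (N := π.N) (fun i hi => (π.pt_lt i hi).le) μ
    rw [π.pt_zero, π.pt_last] at h1
    rw [scheme, h2]
    exact hE.W_run_limit_le hp1 hΘ hβ hCP hκ hst htT h1 π.isFine (π.mesh_pos hst)
      (hθ.tendsto s t hst μ)
  refine ⟨key, ?_⟩
  -- With a single step the mesh is `t - s`, and the two exponents add up.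
  have h := key (Partition.trivial hst)
  have e1 : scheme Θ (Partition.trivial hst) μ = Θ s t μ := by
    simp [scheme, Partition.trivial, compose]
  have e2 : (Partition.trivial hst).mesh = t - s := by
    simp [Partition.mesh, Partition.trivial]
  rw [e1, e2, mul_assoc, ← ENNReal.coe_mul, ← NNReal.rpow_add (tsub_pos_of_lt hst).ne'] at h
  exact h
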